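/- **Definitions.** An *inverse monoid* is a monoid with zero $S$ in which every $a$ has a unique inverse $a^{-1}$, i.e. a unique element with $aa^{-1}a=a$ and $a^{-1}aa^{-1}=a^{-1}$. Its natural partial order is $a\le b$ iff $a=be$ for some idempotent $e$; joins and meets are taken with respect to this order. Elements $a,b$ are *compatible* if $ab^{-1}$ and $a^{-1}b$ are idempotent. A *Boolean inverse $\wedge$-monoid* is an inverse monoid in which every compatible pair has a join, multiplication distributes over all binary joins that exist, the idempotents form a Boolean algebra under the natural partial order, and every pair of elements has a meet. It is *congruence-free* if it has exactly two congruences. For $n\ge 2$ let $A_n$ be an alphabet with $n$ letters. The *Cuntz inverse monoid* $C_n$ consists of all partial bijections of the set $A_n^{\omega}$ of infinite words that are given by a bijection $\varphi\colon X\to Y$ between two finite prefix codes $X,Y\subseteq A_n^{*}$ through $xu\mapsto\varphi(x)u$ ($x\in X$, $u\in A_n^{\omega}$); its multiplication is composition of partial maps. The *Thompson group* $G_{n,1}$ is the group of all permutations of $A_n^{\omega}$ given in the same way by a bijection between two finite complete prefix codes (a prefix code $X$ is complete if every infinite word has a prefix in $X$). **Corollary 1.2.** (a) Let $S$ and $T$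 be two countably infinite, congruence-free Boolean inverse $\wedge$-monoids. Then $S$ and $T$ are isomorphic if and only if their groups of units are isomorphic. (b) For every $n\ge 2$ the Cuntz inverse monoid $C_n$ is a countably infinite, congruence-free Boolean inverse $\wedge$-monoid, and its group of units is isomorphic to the Thompson group $G_{n,1}$. -/

import Mathlib

universe u v

namespace BooleanInverse

section Semigroup

variable {S : Type u} [MonoidWithZero S]

/-- `b` is an inverse of `a` in the sense of inverse semigroup theory. -/
def IsInverse (a b : S) : Prop :=
  a * b * a = a ∧ b * a * b = b

variable (S) in
/-- An inverse monoid (with zero): every element has exactly one inverse. -/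
def IsInverseMonoid : Prop :=
  ∀ a : S, ∃! b : S, IsInverse a b

/-- The natural partial order: `a ≤ b` iff `a` is the product of `b` and an idempotent. -/
def NatLE (a b : S) : Prop :=
  ∃ e : S, IsIdempotentElem e ∧ a = b * e

/-- The compatibility relation: `a b⁻¹` and `a⁻¹ b` are both idempotent.
(In an inverse monoid the inverses `a'` and `b'` exist and are unique.) -/
def Compatible (a b : S) : Prop :=
  ∃ a' b' : S, IsInverse a a' ∧ IsInverse b b' ∧
    IsIdempotentElem (a * b') ∧ IsIdempotentElem (a' * b)

/-- `j` is the join `a ∨ b` with respect to the natural partial order. -/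
def IsJoin (a b j : S) : Prop :=
  NatLE a j ∧ NatLE b j ∧ ∀ c : S, NatLE a c → NatLE b c → NatLE j c

/-- `m` is the meet `a ∧ b` with respect to the natural partial order. -/
def IsMeet (a b m : S) : Prop :=
  NatLE m a ∧ NatLE m b ∧ ∀ c : S, NatLE c a → NatLE c b → NatLE c m

variable (S) in
/-- A distributive inverse monoid: all compatible pairs have joins, and multiplication
distributes (on both sides) over all binary joins that exist. -/
structure IsDistributive : Prop where
  isInverseMonoid : IsInverseMonoid S
  exists_join : ∀ a b : S, Compatible a b → ∃ j : S, IsJoin a b j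
  mul_join : ∀ a b j c : S, IsJoin a b j → IsJoin (c * a) (c * b) (c * j)
  join_mul : ∀ a b j c : S, IsJoin a b j → IsJoin (a * c) (b * c) (j * c)

variable (S) in
/-- A Boolean inverse `∧`-monoid: a distributive inverse monoid whose idempotents form,
under the natural partial order, a Boolean algebra, and in which all binary meets exist. -/
structure IsBooleanInverseMeetMonoid : Prop where
  isDistributive : IsDistributive S
  boolean : ∃ B : BooleanAlgebra {e : S // IsIdempotentElem e},
    ∀ e f : {e : S // IsIdempotentElem e}, B.le e f ↔ NatLE (e : S) (f : S)
  exists_meet : ∀ a b : S, ∃ m : S, IsMeet a b m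

variable (S) in
/-- Congruence-free: there are exactly two congruences. -/
def IsCongruenceFree : Prop :=
  Nat.card (Con S) = 2

end Semigroup

section Tables

variable {α : Type u}

/-- A finite set of pairs of words is the graph of a bijection between two finite prefix codes. -/
def IsPrefixTable (F : Finset (List α × List α)) : Prop :=
  (∀ p ∈ F, ∀ q ∈ F, p.1 <+: q.1 → p = q) ∧ (∀ p ∈ F, ∀ q ∈ F, p.2 <+: q.2 → p = q)

/-- The partial bijection `f` of the space of infinite words is the prefix replacement map
`x u ↦ y u`, where `(x, y)` runs over some bijection between two finite prefix codes. -/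
def HasTable (f : Stream' α ≃. Stream' α) : Prop :=
  ∃ F : Finset (List α × List α), IsPrefixTable F ∧
    ∀ w w' : Stream' α, w' ∈ f w ↔ ∃ p ∈ F, ∃ t : Stream' α, w = p.1 ++ₛ t ∧ w' = p.2 ++ₛ t

theorem HasTable.refl : HasTable (PEquiv.refl (Stream' α)) := by
  refine ⟨{([], [])}, ⟨by simp, by simp⟩, fun w w' => ?_⟩
  simp [eq_comm]

theorem HasTable.bot : HasTable (⊥ : Stream' α ≃. Stream' α) :=
  ⟨∅, ⟨by simp, by simp⟩, fun w w' => by simp⟩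

theorem HasTable.symm {f : Stream' α ≃. Stream' α} (hf : HasTable f) : HasTable f.symm := by
  classical
  obtain ⟨F, ⟨h1, h2⟩, h⟩ := hf
  refine ⟨F.image Prod.swap, ⟨?_, ?_⟩, fun w w' => ?_⟩
  · simp only [Finset.mem_image]
    rintro _ ⟨p, hp, rfl⟩ _ ⟨q, hq, rfl⟩ hpq
    rw [h2 p hp q hq hpq]
  · simp only [Finset.mem_image]
    rintro _ ⟨p, hp, rfl⟩ _ ⟨q, hq, rfl⟩ hpq
    rw [h1 p hp q hq hpq]
  · rw [PEquiv.mem_iff_mem, h]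
    constructor
    · rintro ⟨p, hp, t, h3, h4⟩
      exact ⟨p.swap, Finset.mem_image_of_mem _ hp, t, h4, h3⟩
    · rintro ⟨q, hq, t, h3, h4⟩
      obtain ⟨p, hp, rfl⟩ := Finset.mem_image.1 hq
      exact ⟨p, hp, t, h4, h3⟩

theorem prefix_of_append_eq {x y : List α} {s t : Stream' α} (h : x ++ₛ s = y ++ₛ t)
    (hl : x.length ≤ y.length) : x <+: y := by
  have h1 := congrArg (Stream'.take x.length) h
  rw [Stream'.take_append_of_le_length _ _ _ le_rfl,
    Stream'.take_append_of_le_length _ _ _ hl, List.take_length] at h1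
  exact List.prefix_iff_eq_take.2 h1

/-- Equivalent form: on each cylinder of some fixed depth, `f` is nowhere defined or replaces
the prefix. -/
theorem hasTable_iff [Finite α] (f : Stream' α ≃. Stream' α) :
    HasTable f ↔ ∃ N : ℕ, ∀ x : List α, x.length = N →
      (∀ t, f (x ++ₛ t) = none) ∨ ∃ y : List α, ∀ t, f (x ++ₛ t) = some (y ++ₛ t) := by
  classical
  constructor
  · rintro ⟨F, -, h⟩
    refine ⟨F.sup fun p => p.1.length, fun x hx => ?_⟩
    by_cases hp : ∃ p ∈ F, p.1 <+: x
    · obtain ⟨p, hp, z, rfl⟩ := hp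
      right
      refine ⟨p.2 ++ z, fun t => ?_⟩
      exact (h _ _).2 ⟨p, hp, z ++ₛ t, by rw [Stream'.append_append_stream],
        by rw [Stream'.append_append_stream]⟩
    · left
      intro t
      rw [Option.eq_none_iff_forall_not_mem]
      intro w' hw'
      obtain ⟨p, hpF, s, h1, -⟩ := (h _ _).1 hw'
      refine hp ⟨p, hpF, prefix_of_append_eq h1.symm ?_⟩
      rw [hx]
      exact Finset.le_sup (f := fun p : List α × List α => p.1.length) hpF
  · rintro ⟨N, h⟩
    cases isEmpty_or_nonempty α with
    | inl hα =>
      have hbot : f = ⊥ := by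
        ext1 w
        exact hα.elim w.head
      rw [hbot]
      exact HasTable.bot
    | inr hα =>
      obtain ⟨a⟩ := hα
      let s₀ : Stream' α := Stream'.const a
      let X : Set (List α) := {x | x.length = N ∧ ∃ y : List α, ∀ t, f (x ++ₛ t) = some (y ++ₛ t)}
      have hX : X.Finite := (List.finite_length_eq α N).subset fun x hx => hx.1
      choose! φ hφ using fun x (hx : x ∈ X) => hx.2
      have key : ∀ x ∈ X, ∀ y ∈ X, φ x <+: φ y → x = y := by
        rintro x hx y hy ⟨z, hz⟩
        have h1 := hφ x hx (z ++ₛ s₀)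
        have h2 := hφ y hy s₀
        rw [← hz, Stream'.append_append_stream] at h2
        have h3 := f.inj (Option.mem_def.2 h1) (Option.mem_def.2 h2)
        exact Stream'.append_left_injective _ _ _ _ h3 (hx.1.trans hy.1.symm)
      refine ⟨hX.toFinset.image fun x => (x, φ x), ⟨?_, ?_⟩, fun w w' => ?_⟩
      · simp only [Finset.mem_image, Set.Finite.mem_toFinset]
        rintro _ ⟨x, hx, rfl⟩ _ ⟨y, hy, rfl⟩ hxy
        have hxy' : x = y := List.IsPrefix.eq_of_length hxy (hx.1.trans hy.1.symm)
        rw [hxy']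
      · simp only [Finset.mem_image, Set.Finite.mem_toFinset]
        rintro _ ⟨x, hx, rfl⟩ _ ⟨y, hy, rfl⟩ hxy
        rw [key x hx y hy hxy]
      · simp only [Finset.mem_image, Set.Finite.mem_toFinset]
        constructor
        · intro hw
          have hs : Stream'.take N w ++ₛ Stream'.drop N w = w := Stream'.append_take_drop _ _
          have hmem : Stream'.take N w ∈ X := by
            refine ⟨Stream'.length_take _ _, ?_⟩
            rcases h _ (Stream'.length_take N w) with h1 | h1
            · have h2 := h1 (Stream'.drop N w)
              rw [hs, Option.mem_def.1 hw] at h2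
              cases h2
            · exact h1
          refine ⟨_, ⟨_, hmem, rfl⟩, Stream'.drop N w, hs.symm, ?_⟩
          have h2 := hφ _ hmem (Stream'.drop N w)
          rw [hs, Option.mem_def.1 hw] at h2
          exact Option.some.inj h2
        · rintro ⟨_, ⟨x, hx, rfl⟩, t, rfl, rfl⟩
          exact hφ x hx t

theorem HasTable.trans [Finite α] {f g : Stream' α ≃. Stream' α} (hf : HasTable f)
    (hg : HasTable g) : HasTable (f.trans g) := by
  rw [hasTable_iff] at *
  obtain ⟨M, hM⟩ := hf
  obtain ⟨N, hN⟩ := hg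
  have app : ∀ w, (f.trans g) w = (f w).bind g := fun _ => rfl
  refine ⟨M + N, fun x hx => ?_⟩
  have hx1 : (x.take M).length = M := by rw [List.length_take]; omega
  have hx2 : (x.drop M).length = N := by rw [List.length_drop]; omega
  have hsplit : ∀ t, x ++ₛ t = x.take M ++ₛ (x.drop M ++ₛ t) := fun t => by
    rw [← Stream'.append_append_stream, List.take_append_drop]
  rcases hM _ hx1 with h | ⟨y, hy⟩
  · left
    intro t
    rw [app, hsplit, h]
    rfl
  · have hlen : ((y ++ x.drop M).take N).length = N := by
      rw [List.length_take, List.length_append]; omega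
    have h1 : ∀ t, (f.trans g) (x ++ₛ t) =
        g ((y ++ x.drop M).take N ++ₛ ((y ++ x.drop M).drop N ++ₛ t)) := fun t => by
      rw [app, hsplit, hy, ← Stream'.append_append_stream, ← Stream'.append_append_stream,
        List.take_append_drop]
      rfl
    rcases hN _ hlen with h | ⟨z, hz⟩
    · left
      intro t
      rw [h1, h]
    · right
      refine ⟨z ++ (y ++ x.drop M).drop N, fun t => ?_⟩
      rw [h1, hz, Stream'.append_append_stream]

end Tables

/-- The Cuntz inverse monoid `C_n`, in its faithful representation on the Cantor space of
infinite words over an `n`-letter alphabet: all prefix replacement maps `x u ↦ y u` given by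
a bijection between two finite prefix codes. -/
def CuntzMonoid (n : ℕ) : Type :=
  {f : Stream' (Fin n) ≃. Stream' (Fin n) // HasTable f}

/-- Multiplication is composition of partial bijections (`f * g` is `g` followed by `f`). -/
instance (n : ℕ) : MonoidWithZero (CuntzMonoid n) where
  mul f g := ⟨g.1.trans f.1, g.2.trans f.2⟩
  one := ⟨PEquiv.refl _, HasTable.refl⟩
  zero := ⟨⊥, HasTable.bot⟩
  mul_assoc f g h := Subtype.ext (PEquiv.trans_assoc h.1 g.1 f.1).symm
  one_mul f := Subtype.ext (PEquiv.trans_refl f.1)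
  mul_one f := Subtype.ext (PEquiv.refl_trans f.1)
  zero_mul f := Subtype.ext (PEquiv.trans_bot f.1)
  mul_zero f := Subtype.ext (PEquiv.bot_trans f.1)

/-- A permutation of the space of infinite words is a Thompson permutation if it is the prefix
replacement map `x u ↦ y u` given by a bijection between two finite complete prefix codes. -/
def IsThompsonPerm {α : Type u} (g : Equiv.Perm (Stream' α)) : Prop :=
  ∃ F : Finset (List α × List α), IsPrefixTable F ∧
    (∀ w : Stream' α, ∃ p ∈ F, ∃ t : Stream' α, w = p.1 ++ₛ t) ∧
    (∀ w : Stream' α, ∃ p ∈ F, ∃ t : Stream' α, w = p.2 ++ₛ t) ∧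
    ∀ p ∈ F, ∀ t : Stream' α, g (p.1 ++ₛ t) = p.2 ++ₛ t

theorem isThompsonPerm_iff {α : Type u} (g : Equiv.Perm (Stream' α)) :
    IsThompsonPerm g ↔ HasTable g.toPEquiv := by
  constructor
  · rintro ⟨F, hF, h1, -, h⟩
    refine ⟨F, hF, fun w w' => ?_⟩
    rw [Equiv.toPEquiv_apply, Option.mem_some_iff]
    constructor
    · rintro rfl
      obtain ⟨p, hp, t, rfl⟩ := h1 w
      exact ⟨p, hp, t, rfl, h p hp t⟩
    · rintro ⟨p, hp, t, rfl, rfl⟩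
      exact h p hp t
  · rintro ⟨F, hF, h⟩
    simp only [Equiv.toPEquiv_apply, Option.mem_some_iff] at h
    refine ⟨F, hF, fun w => ?_, fun w => ?_, fun p hp t => ?_⟩
    · obtain ⟨p, hp, t, h1, -⟩ := (h w _).1 rfl
      exact ⟨p, hp, t, h1⟩
    · obtain ⟨p, hp, t, -, h1⟩ := (h (g.symm w) w).1 (by simp)
      exact ⟨p, hp, t, h1⟩
    · exact (h _ _).2 ⟨p, hp, t, rfl, rfl⟩

/-- The Thompson group `G_{n,1}`, acting on the infinite words over an `n`-letter alphabet. -/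
def thompsonGroup (n : ℕ) : Subgroup (Equiv.Perm (Stream' (Fin n))) where
  carrier := {g | IsThompsonPerm g}
  one_mem' := (isThompsonPerm_iff _).2 HasTable.refl
  mul_mem' {a b} ha hb := by
    have h := ((isThompsonPerm_iff b).1 hb).trans ((isThompsonPerm_iff a).1 ha)
    rw [← Equiv.toPEquiv_trans] at h
    exact (isThompsonPerm_iff _).2 h
  inv_mem' {a} ha := by
    have h := ((isThompsonPerm_iff a).1 ha).symm
    rw [← Equiv.toPEquiv_symm] at h
    exact (isThompsonPerm_iff _).2 h

end BooleanInverse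

/-! Part (a). A congruence-free Boolean inverse `∧`-monoid is recovered from the conjugation action
of its units on the Boolean algebra of idempotents, and that action is recovered from the abstract
group.

Congruence-freeness enters twice. The Rees congruence of the ideal generated by a nonzero idempotent
`e` is universal, so some `s` has `s⁻¹s = 1` and `ss⁻¹ ≤ e` (`exists_dom_eq_top`): everything can be
squeezed into `e`. The congruence "same conjugation action" is trivial, so elements are determined
by their action on idempotents (`ext_conj`). With infinitude, which excludes atoms, and with the
meets `g ∧ 1`, which provide supports, this makes the unit group vigorous (`IsVigorous`).

For a vigorous group, a Rubin-style argument expresses inclusion of supports in the language of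
groups (`supp_le_supp_iff`). Every element of the algebra is a support (`exists_supp_eq`), so a
group isomorphism `φ` induces an equivariant isomorphism `β` of the Boolean algebras
(`exists_orderIso`).

To extend `φ` to the monoids, call `s` and `t` corresponding if `β` intertwines their conjugation
actions. Units correspond via `φ` and idempotents via `β`; correspondence respects products and
joins, and every element is a finite join of restrictions of units (`IsCongruenceFree.induction`).
So each `s` has a correspondent, unique by `ext_conj`, which yields the isomorphism.

Part (b). Elements of `C_n` are handled through their graphs: order is inclusion, joins are unions,
idempotents are partial identities on finite unions of cylinders. Congruence-freeness follows by
separating two different elements by idempotents on both sides, and then compressing a nonzero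
element to `1`. Units are the everywhere defined bijections. -/

namespace BooleanInverse

open scoped commutatorElement

/-! ### Groups acting vigorously on a Boolean algebra -/

section Vigorous

variable {G B : Type*} [Group G] [BooleanAlgebra B] (ρ : G →* (B ≃o B))

/-- `g` acts trivially below the complement of `a`. -/
def SupportedIn (g : G) (a : B) : Prop := ∀ x, Disjoint x a → ρ g x = x

/-- A group of automorphisms of an atomless Boolean algebra in which every element has a support
and each element of the algebra can be swapped with a part of any nonzero element disjoint
from it. -/
structure IsVigorous : Prop where
  injective : Function.Injective ρ
  exists_swap : ∀ u v : B, Disjoint u v → v ≠ ⊥ →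
    ∃ g, ρ g u ≤ v ∧ ρ g (ρ g u) = u ∧ SupportedIn ρ g (u ⊔ ρ g u)
  exists_lt : ∀ v : B, v ≠ ⊥ → ∃ w, w ≠ ⊥ ∧ w < v
  exists_support : ∀ g, ∃ a, ∀ b, SupportedIn ρ g b ↔ a ≤ b

variable {ρ}

theorem map_mul_apply (g h : G) (x : B) : ρ (g * h) x = ρ g (ρ h x) := by
  rw [map_mul]; rfl

theorem map_inv_apply (g : G) (x : B) : ρ g⁻¹ (ρ g x) = x := by
  rw [← map_mul_apply, inv_mul_cancel, map_one]; rfl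

theorem map_apply_inv (g : G) (x : B) : ρ g (ρ g⁻¹ x) = x := by
  rw [← map_mul_apply, mul_inv_cancel, map_one]; rfl

theorem disjoint_map {g : G} {x y : B} : Disjoint (ρ g x) (ρ g y) ↔ Disjoint x y :=
  disjoint_map_orderIso_iff (ρ g)

theorem map_eq_bot {g : G} {x : B} : ρ g x = ⊥ ↔ x = ⊥ := map_eq_bot_iff (ρ g)

namespace SupportedIn

variable {g h : G} {a b : B}

theorem mono (hg : SupportedIn ρ g a) (hab : a ≤ b) : SupportedIn ρ g b :=
  fun x hx => hg x (hx.mono_right hab)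

theorem one : SupportedIn ρ (1 : G) a := fun x _ => by rw [map_one]; rfl

theorem mul (hg : SupportedIn ρ g a) (hh : SupportedIn ρ h a) : SupportedIn ρ (g * h) a :=
  fun x hx => by rw [map_mul_apply, hh x hx, hg x hx]

theorem inv (hg : SupportedIn ρ g a) : SupportedIn ρ g⁻¹ a := fun x hx => by
  conv_lhs => rw [← hg x hx]
  exact map_inv_apply g x

theorem pow (hg : SupportedIn ρ g a) : ∀ k : ℕ, SupportedIn ρ (g ^ k) a
  | 0 => by rw [pow_zero]; exact one
  | k + 1 => by rw [pow_succ]; exact (hg.pow k).mul hg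

theorem conj (hg : SupportedIn ρ g a) (h : G) : SupportedIn ρ (h * g * h⁻¹) (ρ h a) :=
  fun x hx => by
    rw [map_mul_apply, map_mul_apply, hg, map_apply_inv]
    rwa [← disjoint_map (ρ := ρ) (g := h), map_apply_inv]

theorem inf (ha : SupportedIn ρ g a) (hb : SupportedIn ρ g b) : SupportedIn ρ g (a ⊓ b) :=
  fun x hx => by
    have h1 : ρ g (x \ a) = x \ a := ha _ disjoint_sdiff_self_left
    have h2 : ρ g (x ⊓ a) = x ⊓ a := hb _ (by rwa [disjoint_assoc])
    rw [← sup_inf_sdiff x a, (ρ g).map_sup, h1, h2]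

theorem map_le (hg : SupportedIn ρ g a) {x : B} (hx : a ≤ x) : ρ g x = x := by
  have h := hg xᶜ (disjoint_compl_left.mono_right hx)
  rw [map_compl'] at h
  exact compl_injective h

theorem map_apply_le (hg : SupportedIn ρ g a) {x : B} (hx : x ≤ a) : ρ g x ≤ a := by
  calc ρ g x ≤ ρ g a := (ρ g).monotone hx
    _ = a := hg.map_le le_rfl

end SupportedIn

/-- If `g` moves `y`, then `y \ g⁻¹y` and `y \ gy` are not both zero, and `g` takes each of them off
itself. -/
theorem exists_disjoint_map {g : G} {a : B} (h : ¬SupportedIn ρ g a) :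
    ∃ x, x ≠ ⊥ ∧ Disjoint x a ∧ Disjoint (ρ g x) x := by
  unfold SupportedIn at h
  push Not at h
  obtain ⟨y, hy, hne⟩ := h
  by_cases h1 : y ≤ ρ g y
  · refine ⟨y \ ρ g⁻¹ y, ?_, hy.mono_left sdiff_le, ?_⟩
    · rw [Ne, sdiff_eq_bot_iff]
      intro h2
      have := (ρ g).monotone h2
      rw [map_apply_inv] at this
      exact hne (le_antisymm this h1)
    · have : Disjoint (ρ g (y \ ρ g⁻¹ y)) (ρ g (ρ g⁻¹ y)) :=
        disjoint_map.2 disjoint_sdiff_self_left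
      rw [map_apply_inv] at this
      exact this.mono_right sdiff_le
  · refine ⟨y \ ρ g y, by rwa [Ne, sdiff_eq_bot_iff], hy.mono_left sdiff_le, ?_⟩
    exact Disjoint.mono_left ((ρ g).monotone sdiff_le) disjoint_sdiff_self_right

namespace IsVigorous

theorem eq_one (hρ : IsVigorous ρ) {g : G} (h : SupportedIn ρ g ⊥) : g = 1 :=
  hρ.injective (by ext x; rw [h x disjoint_bot_right, map_one]; rfl)

/-- The commutator is a product of elements supported in `a`, and also a product of elements
supported in `b`; hence it is supported in `a ⊓ b = ⊥`. -/
theorem commute (hρ : IsVigorous ρ) {g h : G} {a b : B} (hg : SupportedIn ρ g a)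
    (hh : SupportedIn ρ h b) (hab : Disjoint a b) : Commute g h := by
  have hb : ρ g b = b := hg b hab.symm
  have ha : ρ h a = a := hh a hab
  have h1 : SupportedIn ρ (g * h * g⁻¹ * h⁻¹) b := by
    have := hg.inv.conj h
    have h2 := hh.conj g
    rw [hb] at h2
    exact h2.mul hh.inv
  have h2 : SupportedIn ρ (g * h * g⁻¹ * h⁻¹) a := by
    have h2 := hg.inv.conj h
    rw [ha] at h2
    have := hg.mul h2
    simpa only [mul_assoc] using this
  have h3 := hρ.eq_one (g := g * h * g⁻¹ * h⁻¹) (by rw [← hab.eq_bot]; exact h2.inf h1)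
  exact commutatorElement_eq_one_iff_commute.1 h3

/-- The support of a group element. -/
noncomputable def supp (hρ : IsVigorous ρ) (g : G) : B := (hρ.exists_support g).choose

theorem supportedIn_iff (hρ : IsVigorous ρ) {g : G} {a : B} :
    SupportedIn ρ g a ↔ hρ.supp g ≤ a := (hρ.exists_support g).choose_spec a

theorem supportedIn_supp (hρ : IsVigorous ρ) (g : G) : SupportedIn ρ g (hρ.supp g) :=
  hρ.supportedIn_iff.2 le_rfl

theorem supp_conj (hρ : IsVigorous ρ) (g h : G) :
    hρ.supp (h * g * h⁻¹) = ρ h (hρ.supp g) := by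
  apply le_antisymm
  · exact hρ.supportedIn_iff.1 ((hρ.supportedIn_supp g).conj h)
  · have h1 := (hρ.supportedIn_supp (h * g * h⁻¹)).conj h⁻¹
    rw [show h⁻¹ * (h * g * h⁻¹) * h⁻¹⁻¹ = g by group] at h1
    have h2 := (ρ h).monotone (hρ.supportedIn_iff.1 h1)
    rwa [map_apply_inv] at h2

theorem exists_disjoint_le_supp (hρ : IsVigorous ρ) {g : G} {w : B} (hw : w ≠ ⊥)
    (h : w ≤ hρ.supp g) : ∃ x ≤ w, x ≠ ⊥ ∧ Disjoint (ρ g x) x := by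
  have h1 : ¬SupportedIn ρ g wᶜ := by
    rw [hρ.supportedIn_iff]
    intro h2
    exact hw (le_compl_self.1 (h.trans h2))
  obtain ⟨x, hx, h2, h3⟩ := exists_disjoint_map h1
  exact ⟨x, disjoint_compl_right_iff.1 h2, hx, h3⟩

/-- Every nonzero element strictly contains an image of itself under an element of the group. -/
theorem exists_map_lt (hρ : IsVigorous ρ) {v : B} (hv : v ≠ ⊥) :
    ∃ g, SupportedIn ρ g v ∧ ∃ a, ρ g a < a := by
  obtain ⟨w, hw, hwv⟩ := hρ.exists_lt v hv
  obtain ⟨p, hp, hpw⟩ := hρ.exists_lt w hw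
  have hr : v \ w ≠ ⊥ := by rw [Ne, sdiff_eq_bot_iff]; exact hwv.not_ge
  obtain ⟨g, hg1, -, hg3⟩ := hρ.exists_swap w (v \ w) disjoint_sdiff_self_right hr
  have hgv : ρ g w ≤ v := hg1.trans sdiff_le
  -- `g` parks `w` in `v \ w`, and `k` brings it back inside the smaller `p`. The detour is needed
  -- because swaps require disjoint elements.
  obtain ⟨k, hk1, -, hk3⟩ := hρ.exists_swap (ρ g w) p
    (disjoint_sdiff_self_left.mono hg1 hpw.le) hp
  refine ⟨k * g, (hk3.mono ?_).mul (hg3.mono (sup_le hwv.le hgv)), w, ?_⟩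
  · exact sup_le hgv (hk1.trans (hpw.le.trans hwv.le))
  · rw [map_mul_apply]
    exact hk1.trans_lt hpw

theorem exists_pow_ne_one (hρ : IsVigorous ρ) {v : B} (hv : v ≠ ⊥) {k : ℕ} (hk : k ≠ 0) :
    ∃ g, SupportedIn ρ g v ∧ g ^ k ≠ 1 := by
  obtain ⟨g, hg, a, ha⟩ := hρ.exists_map_lt hv
  have key : ∀ m : ℕ, ρ (g ^ (m + 1)) a < a := by
    intro m
    induction m with
    | zero => simpa using ha
    | succ m ih =>
      rw [pow_succ, map_mul_apply]
      exact ((ρ _).strictMono ha).trans ih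
  obtain ⟨m, rfl⟩ := Nat.exists_eq_succ_of_ne_zero hk
  refine ⟨g, hg, fun h => ?_⟩
  have := key m
  rw [← Nat.succ_eq_add_one, h, map_one] at this
  exact lt_irrefl _ this

theorem exists_ne_one (hρ : IsVigorous ρ) {v : B} (hv : v ≠ ⊥) :
    ∃ g, SupportedIn ρ g v ∧ g ≠ 1 := by
  obtain ⟨g, hg, h⟩ := hρ.exists_pow_ne_one hv one_ne_zero
  exact ⟨g, hg, by rwa [pow_one] at h⟩

/-- A nontrivial element supported in `x` does not commute with an element moving `x` off
itself. -/
theorem not_commute (hρ : IsVigorous ρ) {f h : G} {x : B} (hx : Disjoint (ρ f x) x)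
    (hh : SupportedIn ρ h x) (h1 : h ≠ 1) : ¬Commute f h := by
  intro hc
  have h2 := hh.conj f
  rw [hc.eq, mul_inv_cancel_right] at h2
  refine h1 (hρ.eq_one ?_)
  rw [← hx.eq_bot]
  exact h2.inf hh

theorem exists_not_commute (hρ : IsVigorous ρ) {v : B} (hv : v ≠ ⊥) :
    ∃ f g, SupportedIn ρ f v ∧ SupportedIn ρ g v ∧ ¬Commute f g := by
  obtain ⟨f, hf, hf1⟩ := hρ.exists_ne_one hv
  have h1 : ¬SupportedIn ρ f ⊥ := fun h => hf1 (hρ.eq_one h)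
  obtain ⟨x, hx, -, hd⟩ := exists_disjoint_map h1
  have hxv : x ⊓ v ≠ ⊥ := by
    intro h
    have hxv := disjoint_iff.2 h
    rw [hf x hxv] at hd
    exact hx (disjoint_self.1 hd)
  obtain ⟨g, hg, hg1⟩ := hρ.exists_ne_one hxv
  refine ⟨f, g, hf, hg.mono inf_le_right, hρ.not_commute ?_ hg hg1⟩
  exact hd.mono ((ρ f).monotone inf_le_left) inf_le_left

end IsVigorous

/-! ### Disjointness and inclusion of supports in group-theoretic terms -/

/-- A group theoretic substitute for the disjointness of supports, going back to M. Rubin. -/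
def AlgDisjoint (f g : G) : Prop :=
  ∀ h, ¬Commute f h → ∃ f₁ f₂, Commute f₁ g ∧ Commute f₂ g ∧
    Commute ⁅f₁, ⁅f₂, h⁆⁆ g ∧ ⁅f₁, ⁅f₂, h⁆⁆ ≠ 1

namespace IsVigorous

/-- An element `k` not commuting with `f` moves some `x` below the support of `f` off itself. Take
non-commuting `f₁, f₂` supported in `x`. Since `k f₂⁻¹ k⁻¹` lives in `kx`, it commutes with `f₁`,
and the double commutator collapses to `⁅f₁, f₂⁆`, which is supported in `x` and so commutes with
`g`. -/
theorem algDisjoint (hρ : IsVigorous ρ) {f g : G}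
    (h : Disjoint (hρ.supp f) (hρ.supp g)) : AlgDisjoint f g := by
  intro k hk
  have h1 : ¬SupportedIn ρ k (hρ.supp f)ᶜ := fun h1 =>
    hk (hρ.commute (hρ.supportedIn_supp f) h1 disjoint_compl_right)
  obtain ⟨x, hx, hxf, hd⟩ := exists_disjoint_map h1
  rw [disjoint_compl_right_iff] at hxf
  obtain ⟨f₁, f₂, h₁, h₂, hn⟩ := hρ.exists_not_commute hx
  have hc : ∀ {y}, SupportedIn ρ y x → Commute y g := fun hy =>
    hρ.commute hy (hρ.supportedIn_supp g) (h.mono_left hxf)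
  have hcc : Commute f₁ (k * f₂⁻¹ * k⁻¹) := hρ.commute h₁ (h₂.inv.conj k) hd.symm
  have heq : ⁅f₁, ⁅f₂, k⁆⁆ = ⁅f₁, f₂⁆ := by
    have e1 : ⁅f₂, k⁆ = f₂ * (k * f₂⁻¹ * k⁻¹) := by
      rw [commutatorElement_def]; group
    rw [e1, commutatorElement_def, commutatorElement_def, ← mul_assoc f₁ f₂,
      mul_assoc (f₁ * f₂), mul_inv_rev]
    rw [hcc.inv_left.eq.symm]
    group
  refine ⟨f₁, f₂, hc h₁, hc h₂, ?_, ?_⟩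
  · rw [heq, commutatorElement_def]
    exact hc (((h₁.mul h₂).mul h₁.inv).mul h₂.inv)
  · rw [heq, Ne, commutatorElement_eq_one_iff_commute]
    exact hn

/-- The exponent 12 is the least common multiple of 1, 2, 3, 4: the support of `g ^ 12` lies in that
of `g ^ i` for each of these `i`, so `w` can be shrunk four times in succession. -/
theorem exists_disjoint_pow (hρ : IsVigorous ρ) {g : G} {w : B} (hw : w ≠ ⊥)
    (h : w ≤ hρ.supp (g ^ 12)) :
    ∃ x ≤ w, x ≠ ⊥ ∧ ∀ i, 0 < i → i ≤ 4 → Disjoint (ρ (g ^ i) x) x := by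
  have key : ∀ i, i ∣ 12 → ∀ w, w ≠ ⊥ → w ≤ hρ.supp (g ^ 12) →
      ∃ x ≤ w, x ≠ ⊥ ∧ Disjoint (ρ (g ^ i) x) x := by
    rintro i ⟨j, hj⟩ w hw h
    refine hρ.exists_disjoint_le_supp hw (h.trans ?_)
    rw [← hρ.supportedIn_iff, hj, pow_mul]
    exact (hρ.supportedIn_supp _).pow j
  obtain ⟨x₁, hx₁, h₁, d₁⟩ := key 1 (by norm_num) w hw h
  obtain ⟨x₂, hx₂, h₂, d₂⟩ := key 2 (by norm_num) x₁ h₁ (hx₁.trans h)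
  obtain ⟨x₃, hx₃, h₃, d₃⟩ := key 3 (by norm_num) x₂ h₂ (hx₂.trans (hx₁.trans h))
  obtain ⟨x₄, hx₄, h₄, d₄⟩ := key 4 (by norm_num) x₃ h₃ (hx₃.trans (hx₂.trans (hx₁.trans h)))
  refine ⟨x₄, hx₄.trans (hx₃.trans (hx₂.trans hx₁)), h₄, fun i hi hi4 => ?_⟩
  interval_cases i
  · exact d₁.mono ((ρ _).monotone (hx₄.trans (hx₃.trans hx₂))) (hx₄.trans (hx₃.trans hx₂))
  · exact d₂.mono ((ρ _).monotone (hx₄.trans hx₃)) (hx₄.trans hx₃)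
  · exact d₃.mono ((ρ _).monotone hx₄) hx₄
  · exact d₄

/-- If the support of `k` lies in `⋁ uᵢ x` with `uᵢ` in the centralizer of `g`, where there are
fewer `uᵢ` than disjoint translates of `x` under powers of `g`, then `k` cannot commute
with `g` unless it is trivial. -/
theorem eq_one_of_commute (hρ : IsVigorous ρ) {g k : G} {x : B} {ι : Type*} [Fintype ι]
    (u : ι → G) (hu : ∀ i, Commute (u i) g)
    (hx : ∀ i, 0 < i → i ≤ Fintype.card ι → Disjoint (ρ (g ^ i) x) x)
    (hk : SupportedIn ρ k (Finset.univ.sup fun i => ρ (u i) x)) (hkg : Commute k g) : k = 1 := by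
  by_contra hk1
  set m := Finset.univ.sup fun i => ρ (u i) x with hm
  have h1 : ¬SupportedIn ρ k ⊥ := fun h => hk1 (hρ.eq_one h)
  obtain ⟨w, hw, -, hd⟩ := exists_disjoint_map h1
  -- As `k` commutes with `g ^ j`, it moves `g ^ j w` off itself; the part outside `m`, being fixed
  -- by `k`, must vanish.
  have hsub : ∀ j : ℕ, ρ (g ^ j) w ≤ m := by
    intro j
    by_contra hj
    have h2 : ρ k (ρ (g ^ j) w \ m) = ρ (g ^ j) w \ m := hk _ disjoint_sdiff_self_left
    have h3 : Disjoint (ρ k (ρ (g ^ j) w)) (ρ (g ^ j) w) := by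
      rw [← map_mul_apply, (hkg.pow_right j).eq, map_mul_apply]
      exact disjoint_map.2 hd
    have h4 := h3.mono ((ρ k).monotone (sdiff_le (b := m))) (sdiff_le (b := m))
    rw [h2, disjoint_self, sdiff_eq_bot_iff] at h4
    exact hj h4
  -- Shrink `w` until each of its first `N` translates lies inside a single `u i x`.
  have key : ∀ N : ℕ, ∃ y ≤ w, y ≠ ⊥ ∧ ∀ j < N, ∃ i, ρ (g ^ j) y ≤ ρ (u i) x := by
    intro N
    induction N with
    | zero => exact ⟨w, le_rfl, hw, by simp⟩
    | succ N ih =>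
      obtain ⟨y, hyw, hy, ih⟩ := ih
      have h2 : ρ (g ^ N) y ≤ m := ((ρ _).monotone hyw).trans (hsub N)
      have h3 : ∃ i, ¬Disjoint (ρ (g ^ N) y) (ρ (u i) x) := by
        by_contra! h
        have : Disjoint (ρ (g ^ N) y) m := Finset.disjoint_sup_right.2 fun i _ => h i
        have := this.mono_right h2
        rw [disjoint_self, map_eq_bot] at this
        exact hy this
      obtain ⟨i, hi⟩ := h3
      refine ⟨y ⊓ ρ (g ^ N)⁻¹ (ρ (u i) x), inf_le_left.trans hyw, ?_, fun j hj => ?_⟩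
      · intro h
        apply hi
        rw [disjoint_iff, ← map_apply_inv (ρ := ρ) (g ^ N) (ρ (u i) x), ← (ρ _).map_inf, h,
          map_eq_bot]
      · rcases Nat.lt_succ_iff_lt_or_eq.1 hj with hj | rfl
        · obtain ⟨i', hi'⟩ := ih j hj
          exact ⟨i', ((ρ _).monotone inf_le_left).trans hi'⟩
        · refine ⟨i, ?_⟩
          calc _ ≤ ρ (g ^ j) (ρ (g ^ j)⁻¹ (ρ (u i) x)) := (ρ _).monotone inf_le_right
            _ = _ := map_apply_inv _ _
  obtain ⟨y, -, hy, hyi⟩ := key (Fintype.card ι + 1)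
  have : Nonempty ι := by
    obtain ⟨i, -⟩ := hyi 0 (by omega)
    exact ⟨i⟩
  choose! σ hσ using hyi
  -- Pigeonhole: two translates of `y` lie in the same `v x`. Hence some `g ^ (c + 1)` makes `v x`
  -- overlap itself; as `v` commutes with `g`, it would make `x` overlap itself too.
  have : ∃ a b : Fin (Fintype.card ι + 1), a ≠ b ∧ σ a = σ b :=
    Fintype.exists_ne_map_eq_of_card_lt (fun a : Fin (Fintype.card ι + 1) => σ a) (by simp)
  have wlog_lt : ∃ a b : ℕ, a < b ∧ b < Fintype.card ι + 1 ∧ σ a = σ b := by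
    obtain ⟨a, b, hab, h⟩ := this
    rcases lt_or_gt_of_ne hab with h' | h'
    · exact ⟨a, b, h', b.2, h⟩
    · exact ⟨b, a, h', a.2, h.symm⟩
  obtain ⟨a, b, hab, hb, h⟩ := wlog_lt
  have ha := hσ a (hab.trans hb)
  have hb' := hσ b hb
  rw [← h] at hb'
  obtain ⟨c, rfl⟩ := Nat.exists_eq_add_of_lt hab
  set v := u (σ a)
  have hdis := hx (c + 1) (by omega) (by omega)
  have hcomm : Commute v (g ^ (c + 1)) := (hu (σ a)).pow_right _
  have h2 : Disjoint (ρ (g ^ (c + 1)) (ρ v x)) (ρ v x) := by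
    rw [← map_mul_apply, ← hcomm.eq, map_mul_apply]
    exact disjoint_map.2 hdis
  have h3 : ρ (g ^ (a + c + 1)) y = ρ (g ^ (c + 1)) (ρ (g ^ a) y) := by
    rw [← map_mul_apply, ← pow_add]; congr 3; omega
  have h4 : ρ (g ^ (a + c + 1)) y ≤ ρ (g ^ (c + 1)) (ρ v x) := by
    rw [h3]; exact (ρ _).monotone ha
  have h5 := h2.mono h4 hb'
  rw [disjoint_self, map_eq_bot] at h5
  exact hy h5

/-- Weak converse of `algDisjoint`. If the supports met, a nontrivial `k` supported in a small `y`
would fail to commute with `f`. The resulting double commutator is supported in four translates of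
`y` by elements commuting with `g`, while `g` moves `y` off itself in its first four powers, so
`eq_one_of_commute` forces it to be trivial. -/
theorem disjoint_of_algDisjoint (hρ : IsVigorous ρ) {f g : G} (h : AlgDisjoint f g) :
    Disjoint (hρ.supp f) (hρ.supp (g ^ 12)) := by
  by_contra hd
  rw [disjoint_iff] at hd
  obtain ⟨x, hx, hx0, hxd⟩ := hρ.exists_disjoint_pow hd inf_le_right
  obtain ⟨y, hy, hy0, hyd⟩ := hρ.exists_disjoint_le_supp hx0 (hx.trans inf_le_left)
  obtain ⟨k, hk, hk1⟩ := hρ.exists_ne_one hy0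
  obtain ⟨f₁, f₂, h₁, h₂, hc, hne⟩ := h k (hρ.not_commute hyd hk hk1)
  -- Expanding `⁅f₁, ⁅f₂, k⁆⁆` gives a product of conjugates of `k` and `k⁻¹` by exactly these four
  -- elements.
  let u : Fin 4 → G := ![1, f₁, f₂, f₁ * f₂]
  have hu : ∀ i, Commute (u i) g := by
    intro i
    fin_cases i
    exacts [Commute.one_left g, h₁, h₂, h₁.mul_left h₂]
  refine hne (hρ.eq_one_of_commute (x := y) u hu (fun i hi hi' => ?_) ?_ hc)
  · exact (hxd i hi (by simpa using hi')).mono ((ρ _).monotone hy) hy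
  · have hle : ∀ i, ρ (u i) y ≤ Finset.univ.sup fun i => ρ (u i) y := fun i =>
      Finset.le_sup (f := fun i => ρ (u i) y) (Finset.mem_univ i)
    have e0 : SupportedIn ρ k (Finset.univ.sup fun i => ρ (u i) y) := by
      refine hk.mono (le_trans (le_of_eq ?_) (hle 0))
      change y = ρ 1 y
      rw [map_one]; rfl
    have e1 := (hk.inv.conj f₁).mono (hle 1)
    have e2 := (hk.conj f₂).mono (hle 2)
    have e3 := (hk.conj (f₁ * f₂)).mono (hle 3)
    have : ⁅f₁, ⁅f₂, k⁆⁆ = (f₁ * f₂ * k * (f₁ * f₂)⁻¹) * (f₁ * k⁻¹ * f₁⁻¹) *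
        (k * (f₂ * k * f₂⁻¹)⁻¹) := by
      simp only [commutatorElement_def]; group
    rw [this]
    exact (e3.mul e1).mul (e0.mul e2.inv)

/-- The right-hand side mentions only the group, so isomorphisms preserve it. If inclusion fails,
choose `x` outside the support of `f` moved off itself by `h`, and `g` supported in `x` with `g ^ 12
≠ 1`. -/
theorem supp_le_supp_iff (hρ : IsVigorous ρ) {f h : G} :
    hρ.supp h ≤ hρ.supp f ↔ ∀ g, AlgDisjoint f g → Commute h (g ^ 12) := by
  constructor
  · intro hle g hg
    exact hρ.commute (hρ.supportedIn_supp h) (hρ.supportedIn_supp _)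
      ((hρ.disjoint_of_algDisjoint hg).mono_left hle)
  · intro hc
    by_contra hle
    have h1 : hρ.supp h \ hρ.supp f ≠ ⊥ := by rwa [Ne, sdiff_eq_bot_iff]
    obtain ⟨x, hx, hx0, hxd⟩ := hρ.exists_disjoint_le_supp h1 sdiff_le
    obtain ⟨g, hg, hg1⟩ := hρ.exists_pow_ne_one hx0 (k := 12) (by norm_num)
    refine hρ.not_commute hxd (hg.pow 12) hg1 (hc g (hρ.algDisjoint ?_))
    exact disjoint_sdiff_self_right.mono_right ((hρ.supportedIn_iff.1 hg).trans hx)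

/-- Cut `a` into `b`, a copy `g b` and the rest `r`. With `g` swapping `b` and `g b`, and `h`
swapping `r` into `b`, the product `h * g` sends `b` to `g b`, `g b` into `b ⊔ r`, and `r` into `b`:
each piece is moved off itself, so lies in the support. -/
theorem exists_supp_eq (hρ : IsVigorous ρ) (a : B) : ∃ g, hρ.supp g = a := by
  by_cases ha : a = ⊥
  · exact ⟨1, by rw [ha, ← le_bot_iff, ← hρ.supportedIn_iff]; exact SupportedIn.one⟩
  obtain ⟨b, hb, hba⟩ := hρ.exists_lt a ha
  have hr : a \ b ≠ ⊥ := by rw [Ne, sdiff_eq_bot_iff]; exact hba.not_ge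
  obtain ⟨g, hg1, hg2, hg3⟩ := hρ.exists_swap b (a \ b) disjoint_sdiff_self_right hr
  have hga : ρ g b ≤ a := hg1.trans sdiff_le
  have hbg : Disjoint b (ρ g b) := disjoint_sdiff_self_right.mono_right hg1
  set r := a \ (b ⊔ ρ g b) with hrdef
  have hrb : Disjoint r b := disjoint_sdiff_self_left.mono_right le_sup_left
  have hrg : Disjoint r (ρ g b) := disjoint_sdiff_self_left.mono_right le_sup_right
  obtain ⟨h, hh1, hh2, hh3⟩ := hρ.exists_swap r b hrb hb
  have hfix : ρ h (ρ g b) = ρ g b := hh3 _ (by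
    rw [disjoint_sup_right]
    exact ⟨hrg.symm, hbg.symm.mono_right hh1⟩)
  have hbr : ρ h b ≤ b ⊔ r := by
    refine (hh3.mono (b := b ⊔ r) ?_).map_apply_le le_sup_left
    exact sup_le le_sup_right (hh1.trans le_sup_left)
  refine ⟨h * g, le_antisymm ?_ ?_⟩
  · rw [← hρ.supportedIn_iff]
    exact (hh3.mono (sup_le sdiff_le (hh1.trans hba.le))).mul (hg3.mono (sup_le hba.le hga))
  · have key : ∀ c, Disjoint (ρ (h * g) c) c → c ≤ hρ.supp (h * g) := by
      intro c hc
      have h1 := hρ.supportedIn_supp (h * g) (c \ hρ.supp (h * g)) disjoint_sdiff_self_left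
      have h2 := hc.mono ((ρ _).monotone (sdiff_le (b := hρ.supp (h * g))))
        (sdiff_le (b := hρ.supp (h * g)))
      rwa [h1, disjoint_self, sdiff_eq_bot_iff] at h2
    have ha' : a = (b ⊔ ρ g b) ⊔ r := (sup_sdiff_cancel_right (sup_le hba.le hga)).symm
    rw [ha']
    refine sup_le (sup_le (key _ ?_) (key _ ?_)) (key _ ?_)
    · rw [map_mul_apply, hfix]
      exact hbg.symm
    · rw [map_mul_apply, hg2]
      refine Disjoint.mono_left hbr ?_
      rw [disjoint_sup_left]
      exact ⟨hbg, hrg⟩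
    · have : ρ g r = r := hg3 _ disjoint_sdiff_self_left
      rw [map_mul_apply, this]
      exact hrb.symm.mono_left hh1

end IsVigorous

/-! ### Reconstructing the Boolean algebra from the group -/

section Reconstruction

variable {G' B' : Type*} [Group G'] [BooleanAlgebra B'] {ρ' : G' →* (B' ≃o B')}

theorem commute_map_iff (φ : G ≃* G') {f g : G} : Commute (φ f) (φ g) ↔ Commute f g := by
  constructor
  · intro h
    have := h.map φ.symm
    simpa using this
  · intro h
    exact h.map φ

theorem AlgDisjoint.map {f g : G} (h : AlgDisjoint f g) (φ : G ≃* G') :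
    AlgDisjoint (φ f) (φ g) := by
  intro k hk
  obtain ⟨k, rfl⟩ := φ.surjective k
  rw [commute_map_iff] at hk
  obtain ⟨f₁, f₂, h₁, h₂, h₃, h₄⟩ := h k hk
  refine ⟨φ f₁, φ f₂, (commute_map_iff φ).2 h₁, (commute_map_iff φ).2 h₂, ?_, ?_⟩
  · rw [← map_commutatorElement, ← map_commutatorElement]
    exact (commute_map_iff φ).2 h₃
  · rw [← map_commutatorElement, ← map_commutatorElement]
    exact (map_ne_one_iff φ φ.injective).2 h₄

theorem algDisjoint_map_iff (φ : G ≃* G') {f g : G} :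
    AlgDisjoint (φ f) (φ g) ↔ AlgDisjoint f g := by
  refine ⟨fun h => ?_, fun h => h.map φ⟩
  have := h.map φ.symm
  simpa using this

theorem IsVigorous.supp_map_le_iff (hρ : IsVigorous ρ) (hρ' : IsVigorous ρ') (φ : G ≃* G')
    {f h : G} : hρ'.supp (φ h) ≤ hρ'.supp (φ f) ↔ hρ.supp h ≤ hρ.supp f := by
  rw [hρ.supp_le_supp_iff, hρ'.supp_le_supp_iff, φ.surjective.forall]
  refine forall_congr' fun g => ?_
  rw [algDisjoint_map_iff, ← map_pow, commute_map_iff]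

/-- An isomorphism between vigorous groups is induced by an isomorphism of the Boolean algebras
on which they act. -/
theorem IsVigorous.exists_orderIso (hρ : IsVigorous ρ) (hρ' : IsVigorous ρ') (φ : G ≃* G') :
    ∃ β : B ≃o B', ∀ g x, β (ρ g x) = ρ' (φ g) (β x) := by
  choose γ hγ using hρ.exists_supp_eq
  have key : ∀ {f h : G}, hρ.supp h = hρ.supp f → hρ'.supp (φ h) = hρ'.supp (φ f) :=
    fun h => le_antisymm ((hρ.supp_map_le_iff hρ' φ).2 h.le)
      ((hρ.supp_map_le_iff hρ' φ).2 h.ge)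
  -- `γ a` is an arbitrary element with support `a`; by `key` the value does not depend on that
  -- choice.
  let β₀ : B ↪o B' := OrderEmbedding.ofMapLEIff (fun a => hρ'.supp (φ (γ a))) fun a b => by
    rw [hρ.supp_map_le_iff hρ', hγ, hγ]
  have hβ₀ : ∀ g, β₀ (hρ.supp g) = hρ'.supp (φ g) := fun g => key (hγ _)
  have hsurj : Function.Surjective β₀ := by
    intro b
    obtain ⟨g, hg⟩ := hρ'.exists_supp_eq b
    obtain ⟨g, rfl⟩ := φ.surjective g
    exact ⟨hρ.supp g, (hβ₀ g).trans hg⟩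
  refine ⟨RelIso.ofSurjective β₀ hsurj, fun g x => ?_⟩
  obtain ⟨f, rfl⟩ := hρ.exists_supp_eq x
  change β₀ _ = ρ' _ (β₀ _)
  rw [← hρ.supp_conj, hβ₀, hβ₀, ← hρ'.supp_conj]
  simp

end Reconstruction

end Vigorous

/-! ### Elementary theory of inverse monoids -/

/-- A choice of inverses in an inverse monoid, as data. -/
class InverseMonoid (S : Type u) [MonoidWithZero S] extends Inv S where
  isInverse_inv (a : S) : IsInverse a a⁻¹
  eq_inv {a b : S} : IsInverse a b → b = a⁻¹

section InverseMonoid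

variable {S : Type u} [MonoidWithZero S]

theorem IsInverse.symm {a b : S} (h : IsInverse a b) : IsInverse b a := ⟨h.2, h.1⟩

theorem IsIdempotentElem.isInverse_self {e : S} (he : IsIdempotentElem e) : IsInverse e e := by
  have : e * e = e := he
  simp [IsInverse, this]

theorem idem_mul_self {e : S} (he : IsIdempotentElem e) : e * e = e := he

theorem idem_mul_assoc {e : S} (he : IsIdempotentElem e) (x : S) : e * (e * x) = e * x := by
  rw [← mul_assoc, idem_mul_self he]

theorem NatLE.refl (a : S) : NatLE a a := ⟨1, IsIdempotentElem.one, (mul_one a).symm⟩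

theorem NatLE.zero (a : S) : NatLE 0 a := ⟨0, IsIdempotentElem.zero, (mul_zero a).symm⟩

theorem isJoin_zero_left (b : S) : IsJoin 0 b b := ⟨NatLE.zero b, NatLE.refl b, fun _ _ h => h⟩

theorem isJoin_zero_right (b : S) : IsJoin b 0 b := ⟨NatLE.refl b, NatLE.zero b, fun _ h _ => h⟩

theorem IsIdempotentElem.natLE_one {a : S} (h : IsIdempotentElem a) : NatLE a 1 :=
  ⟨a, h, (one_mul a).symm⟩

variable [InverseMonoid S]

open InverseMonoid

theorem mul_inv_mul_self (a : S) : a * a⁻¹ * a = a := (isInverse_inv a).1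

theorem inv_mul_inv_self (a : S) : a⁻¹ * a * a⁻¹ = a⁻¹ := (isInverse_inv a).2

theorem mul_inv_mul_self' (a : S) : a * (a⁻¹ * a) = a := by rw [← mul_assoc, mul_inv_mul_self]

theorem mul_inv_mul_assoc (a b : S) : a * (a⁻¹ * (a * b)) = a * b := by
  rw [← mul_assoc, ← mul_assoc, mul_inv_mul_self]

theorem inv_mul_inv_assoc (a b : S) : a⁻¹ * (a * (a⁻¹ * b)) = a⁻¹ * b := by
  rw [← mul_assoc, ← mul_assoc, inv_mul_inv_self]

theorem inv_inv_self (a : S) : a⁻¹⁻¹ = a := (eq_inv (isInverse_inv a).symm).symm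

theorem idem_inv {e : S} (he : IsIdempotentElem e) : e⁻¹ = e :=
  (eq_inv (IsIdempotentElem.isInverse_self he)).symm

/-- With `x` the inverse of `ef`, the element `fxe` is an inverse of `ef` as well and is idempotent.
By uniqueness `x = fxe`, so `x` is its own inverse, which is `ef`. -/
theorem isIdempotentElem_mul {e f : S} (he : IsIdempotentElem e) (hf : IsIdempotentElem f) :
    IsIdempotentElem (e * f) := by
  set x := (e * f)⁻¹ with hx
  have h1 : e * (f * (x * (e * f))) = e * f := by
    have := mul_inv_mul_self (e * f)
    rw [← hx] at this
    simpa only [mul_assoc] using this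
  have h2 : x * (e * (f * x)) = x := by
    have := inv_mul_inv_self (e * f)
    rw [← hx] at this
    simpa only [mul_assoc] using this
  have h2' : ∀ z, x * (e * (f * (x * z))) = x * z := fun z => by
    conv_rhs => rw [← h2]
    simp only [mul_assoc]
  have h3 : f * (x * e) = x := by
    refine eq_inv ⟨?_, ?_⟩
    · simp only [mul_assoc, idem_mul_assoc he, idem_mul_assoc hf]
      exact h1
    · simp only [mul_assoc, idem_mul_assoc he, idem_mul_assoc hf, h2']
  have h4 : IsIdempotentElem x := by
    have : f * (x * e) * (f * (x * e)) = f * (x * e) := by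
      simp only [mul_assoc, h2']
    rwa [h3] at this
  have h5 : x = e * f := by
    rw [← idem_inv h4, hx, inv_inv_self]
  rwa [h5] at h4

theorem idem_commute {e f : S} (he : IsIdempotentElem e) (hf : IsIdempotentElem f) :
    e * f = f * e := by
  have h1 := isIdempotentElem_mul he hf
  have h2 := isIdempotentElem_mul hf he
  have : f * e = (e * f)⁻¹ := by
    refine eq_inv ⟨?_, ?_⟩
    · have := idem_mul_self h1
      simp only [mul_assoc, idem_mul_assoc he, idem_mul_assoc hf] at this ⊢
      exact this
    · have := idem_mul_self h2
      simp only [mul_assoc, idem_mul_assoc he, idem_mul_assoc hf] at this ⊢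
      exact this
  rw [this, idem_inv h1]

theorem isIdempotentElem_inv_mul (a : S) : IsIdempotentElem (a⁻¹ * a) := by
  change _ * _ = _
  rw [← mul_assoc, inv_mul_inv_self]

theorem isIdempotentElem_mul_inv (a : S) : IsIdempotentElem (a * a⁻¹) := by
  change _ * _ = _
  rw [← mul_assoc, mul_inv_mul_self]

theorem inv_mul_rev (a b : S) : (a * b)⁻¹ = b⁻¹ * a⁻¹ := by
  symm
  have hc := idem_commute (isIdempotentElem_inv_mul a) (isIdempotentElem_mul_inv b)
  have hc' : ∀ z, a⁻¹ * (a * (b * (b⁻¹ * z))) = b * (b⁻¹ * (a⁻¹ * (a * z))) := fun z => by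
    have := congrArg (· * z) hc
    simpa only [mul_assoc] using this
  refine eq_inv ⟨?_, ?_⟩
  · simp only [mul_assoc]
    rw [← hc', mul_inv_mul_assoc, ← mul_assoc b, mul_inv_mul_self]
  · simp only [mul_assoc]
    rw [hc', inv_mul_inv_assoc, ← mul_assoc a⁻¹ a, inv_mul_inv_self]

theorem isIdempotentElem_conj (a : S) {e : S} (he : IsIdempotentElem e) :
    IsIdempotentElem (a * e * a⁻¹) := by
  have hc := idem_commute (isIdempotentElem_inv_mul a) he
  change _ * _ = _
  calc a * e * a⁻¹ * (a * e * a⁻¹) = a * (e * ((a⁻¹ * a) * e)) * a⁻¹ := by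
        simp only [mul_assoc]
    _ = a * (e * (e * (a⁻¹ * a))) * a⁻¹ := by rw [hc]
    _ = a * e * (a⁻¹ * a * a⁻¹) := by rw [idem_mul_assoc he]; simp only [mul_assoc]
    _ = _ := by rw [inv_mul_inv_self]

theorem mul_idem_eq (a : S) {e : S} (he : IsIdempotentElem e) : a * e = a * e * a⁻¹ * a := by
  have hc := idem_commute (isIdempotentElem_inv_mul a) he
  calc a * e = a * (a⁻¹ * a * e) := by rw [← mul_assoc, mul_inv_mul_self']
    _ = a * (e * (a⁻¹ * a)) := by rw [hc]
    _ = _ := by simp only [mul_assoc]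

theorem idem_mul_eq (a : S) {e : S} (he : IsIdempotentElem e) : e * a = a * (a⁻¹ * e * a) := by
  have hc := idem_commute (isIdempotentElem_mul_inv a) he
  calc e * a = e * (a * a⁻¹) * a := by rw [mul_assoc, mul_inv_mul_self]
    _ = _ := by rw [← hc]; simp only [mul_assoc]

theorem isIdempotentElem_conj' (a : S) {e : S} (he : IsIdempotentElem e) :
    IsIdempotentElem (a⁻¹ * e * a) := by
  have := isIdempotentElem_conj a⁻¹ he
  rwa [inv_inv_self] at this

theorem natLE_iff {a b : S} : NatLE a b ↔ a = b * (a⁻¹ * a) := by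
  constructor
  · rintro ⟨e, he, rfl⟩
    have hc := idem_commute (isIdempotentElem_inv_mul b) he
    rw [inv_mul_rev, idem_inv he]
    calc b * e = b * (b⁻¹ * b * e) * e := by
          rw [← mul_assoc, mul_inv_mul_self', mul_assoc, idem_mul_self he]
      _ = _ := by rw [hc]; simp only [mul_assoc]
  · intro h
    exact ⟨_, isIdempotentElem_inv_mul a, h⟩

theorem natLE_idem_mul (b : S) {e : S} (he : IsIdempotentElem e) : NatLE (e * b) b :=
  ⟨_, isIdempotentElem_conj' b he, idem_mul_eq b he⟩

theorem NatLE.eq_mul {a b : S} (h : NatLE a b) : a = b * (a⁻¹ * a) := natLE_iff.1 h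

theorem NatLE.eq_mul' {a b : S} (h : NatLE a b) : a = a * a⁻¹ * b := by
  obtain ⟨e, he, rfl⟩ := h
  have h1 := mul_idem_eq b he
  have hc := idem_commute (isIdempotentElem_inv_mul b) he
  rw [inv_mul_rev, idem_inv he]
  conv_lhs => rw [h1]
  simp only [mul_assoc, idem_mul_assoc he]

theorem NatLE.trans {a b c : S} (h : NatLE a b) (h' : NatLE b c) : NatLE a c := by
  obtain ⟨e, he, rfl⟩ := h
  obtain ⟨f, hf, rfl⟩ := h'
  exact ⟨f * e, isIdempotentElem_mul hf he, mul_assoc _ _ _⟩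

theorem NatLE.antisymm {a b : S} (h : NatLE a b) (h' : NatLE b a) : a = b := by
  obtain ⟨e, he, h1⟩ := h
  obtain ⟨f, hf, h2⟩ := h'
  have h3 : a * e = a := by rw [h1, mul_assoc, idem_mul_self he]
  have h4 : b * f = b := by rw [h2, mul_assoc, idem_mul_self hf]
  calc a = b * e := h1
    _ = a * f * e := by rw [← h2]
    _ = a * e * f := by rw [mul_assoc, mul_assoc, idem_commute hf he]
    _ = b := by rw [h3, ← h2]

theorem NatLE.inv {a b : S} (h : NatLE a b) : NatLE a⁻¹ b⁻¹ := by
  obtain ⟨e, he, rfl⟩ := h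
  rw [inv_mul_rev, idem_inv he]
  exact natLE_idem_mul _ he

theorem NatLE.isIdempotentElem {a b : S} (h : NatLE a b) (hb : IsIdempotentElem b) :
    IsIdempotentElem a := by
  obtain ⟨e, he, rfl⟩ := h
  exact isIdempotentElem_mul hb he

theorem natLE_idem_iff {e f : S} (he : IsIdempotentElem e) : NatLE e f ↔ e = f * e := by
  rw [natLE_iff, idem_inv he, idem_mul_self he]

theorem coe_units_inv (g : Sˣ) : (g : S)⁻¹ = ↑g⁻¹ :=
  (eq_inv ⟨by simp, by simp⟩).symm

theorem compatible_iff {a b : S} :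
    Compatible a b ↔ IsIdempotentElem (a * b⁻¹) ∧ IsIdempotentElem (a⁻¹ * b) := by
  constructor
  · rintro ⟨a', b', ha, hb, h⟩
    rwa [eq_inv ha, eq_inv hb] at h
  · rintro h
    exact ⟨_, _, isInverse_inv a, isInverse_inv b, h⟩

theorem IsJoin.unique {a b j j' : S} (h : IsJoin a b j) (h' : IsJoin a b j') : j = j' :=
  (h.2.2 _ h'.1 h'.2.1).antisymm (h'.2.2 _ h.1 h.2.1)

end InverseMonoid

/-- The type of idempotents. -/
abbrev Idem (S : Type u) [MonoidWithZero S] : Type u := {e : S // IsIdempotentElem e}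

/-! ### Boolean inverse monoids and congruence-freeness -/

/-- A Boolean inverse `∧`-monoid with its Boolean algebra of idempotents, as data. -/
class BooleanInverseMonoid (S : Type u) [MonoidWithZero S] extends InverseMonoid S where
  isDistributive : IsDistributive S
  [booleanAlgebra : BooleanAlgebra (Idem S)]
  le_iff_natLE (e f : Idem S) : e ≤ f ↔ NatLE (e : S) (f : S)
  exists_meet (a b : S) : ∃ m, IsMeet a b m

attribute [reducible, instance] BooleanInverseMonoid.booleanAlgebra

theorem IsBooleanInverseMeetMonoid.nonempty {S : Type u} [MonoidWithZero S]
    (h : IsBooleanInverseMeetMonoid S) : Nonempty (BooleanInverseMonoid S) := by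
  obtain ⟨B, hB⟩ := h.boolean
  choose i hi hu using h.isDistributive.isInverseMonoid
  exact ⟨{ inv := i
           isInverse_inv := hi
           eq_inv := fun {a b} hab => hu a b hab
           isDistributive := h.isDistributive
           booleanAlgebra := B
           le_iff_natLE := hB
           exists_meet := h.exists_meet }⟩

section

variable {S : Type u} [MonoidWithZero S]

namespace IsCongruenceFree

theorem zero_ne_one (h : IsCongruenceFree S) : (0 : S) ≠ 1 := by
  intro h01
  have : Subsingleton S := subsingleton_of_zero_eq_one h01
  have h2 : Subsingleton (Con S) := ⟨fun c d => Con.ext fun x y => by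
    rw [Subsingleton.elim x y]; exact ⟨fun _ => d.refl y, fun _ => c.refl y⟩⟩
  obtain ⟨x, y, hxy, -⟩ := Nat.card_eq_two_iff.1 h
  exact hxy (Subsingleton.elim x y)

theorem eq_or_forall (h : IsCongruenceFree S) (c : Con S) :
    (∀ x y, c x y → x = y) ∨ ∀ x y, c x y := by
  obtain ⟨p, q, -, hpq⟩ := Nat.card_eq_two_iff.1 h
  have hmem : ∀ c : Con S, c = p ∨ c = q := fun c => by
    have : c ∈ ({p, q} : Set (Con S)) := hpq ▸ Set.mem_univ c
    simpa using this
  have hne : (⊥ : Con S) ≠ ⊤ := by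
    intro h1
    refine h.zero_ne_one ?_
    have : (⊤ : Con S) 0 1 := trivial
    rwa [← h1] at this
  have : c = ⊥ ∨ c = ⊤ := by
    rcases hmem ⊥ with h1 | h1 <;> rcases hmem ⊤ with h2 | h2 <;> rcases hmem c with h3 | h3 <;>
      simp_all
  rcases this with rfl | rfl
  · exact Or.inl fun x y h => h
  · exact Or.inr fun x y => trivial

end IsCongruenceFree

end

section BooleanInverseMonoid

variable {S : Type u} [MonoidWithZero S] [BooleanInverseMonoid S]

open InverseMonoid BooleanInverseMonoid

namespace Idem

theorem le_iff {e f : Idem S} : e ≤ f ↔ (e : S) = f * e := by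
  rw [le_iff_natLE, natLE_idem_iff e.2]

theorem le_iff' {e f : Idem S} : e ≤ f ↔ (e : S) = e * f := by
  rw [le_iff, idem_commute e.2 f.2]

theorem coe_inf (e f : Idem S) : ((e ⊓ f : Idem S) : S) = e * f := by
  have : e ⊓ f = ⟨e * f, isIdempotentElem_mul e.2 f.2⟩ := by
    apply le_antisymm
    · rw [le_iff']
      have h1 := le_iff'.1 (inf_le_left : e ⊓ f ≤ e)
      have h2 := le_iff'.1 (inf_le_right : e ⊓ f ≤ f)
      change ((e ⊓ f : Idem S) : S) = (e ⊓ f : Idem S) * (e * f)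
      rw [← mul_assoc, ← h1, ← h2]
    · refine le_inf (le_iff.2 ?_) (le_iff'.2 ?_)
      · exact (idem_mul_assoc e.2 _).symm
      · change _ = (e * f : S) * f
        rw [mul_assoc, idem_mul_self f.2]
  rw [this]

theorem coe_top : ((⊤ : Idem S) : S) = 1 := by
  have h : (⟨1, IsIdempotentElem.one⟩ : Idem S) ≤ ⊤ := le_top
  rw [le_iff] at h
  change 1 = ((⊤ : Idem S) : S) * 1 at h
  rw [h, mul_one]

theorem coe_bot : ((⊥ : Idem S) : S) = 0 := by
  have h : (⊥ : Idem S) ≤ ⟨0, IsIdempotentElem.zero⟩ := bot_le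
  rw [le_iff] at h
  rw [h]
  exact zero_mul _

theorem eq_bot_iff {e : Idem S} : e = ⊥ ↔ (e : S) = 0 := by
  rw [← coe_bot, Subtype.ext_iff]

theorem disjoint_iff {e f : Idem S} : Disjoint e f ↔ (e : S) * f = 0 := by
  rw [_root_.disjoint_iff, eq_bot_iff, coe_inf]

/-- The join in the whole monoid lies below `1`, hence is idempotent, so it agrees with the supremum
in the Boolean algebra. This makes distributivity of multiplication applicable to suprema of
idempotents. -/
theorem isJoin_sup (e f : Idem S) : IsJoin (e : S) f ((e ⊔ f : Idem S) : S) := by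
  have hc : Compatible (e : S) f := by
    rw [compatible_iff, idem_inv e.2, idem_inv f.2]
    exact ⟨isIdempotentElem_mul e.2 f.2, isIdempotentElem_mul e.2 f.2⟩
  obtain ⟨j, hj⟩ := isDistributive.exists_join (e : S) f hc
  have hj1 : IsIdempotentElem j :=
    (hj.2.2 1 (IsIdempotentElem.natLE_one e.2) (IsIdempotentElem.natLE_one f.2)).isIdempotentElem
      IsIdempotentElem.one
  have : e ⊔ f = ⟨j, hj1⟩ := by
    apply le_antisymm
    · exact sup_le ((le_iff_natLE _ _).2 hj.1) ((le_iff_natLE _ _).2 hj.2.1)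
    · exact (le_iff_natLE _ _).2 (hj.2.2 _ ((le_iff_natLE _ _).1 le_sup_left)
        ((le_iff_natLE _ _).1 le_sup_right))
  rw [this]
  exact hj

end Idem

/-- The partial action of an element by conjugation on the idempotents. -/
def conj (s : S) (e : Idem S) : Idem S := ⟨s * e * s⁻¹, isIdempotentElem_conj s e.2⟩

theorem coe_conj (s : S) (e : Idem S) : (conj s e : S) = s * e * s⁻¹ := rfl

theorem conj_mul (s t : S) (e : Idem S) : conj (s * t) e = conj s (conj t e) := by
  apply Subtype.ext
  simp only [coe_conj, inv_mul_rev, mul_assoc]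

theorem conj_one (e : Idem S) : conj 1 e = e := by
  apply Subtype.ext
  rw [coe_conj, idem_inv IsIdempotentElem.one, one_mul, mul_one]

theorem conj_idem (e f : Idem S) : conj (e : S) f = e ⊓ f := by
  apply Subtype.ext
  rw [coe_conj, Idem.coe_inf, idem_inv e.2, mul_assoc, idem_commute f.2 e.2, idem_mul_assoc e.2]

theorem conj_mono (s : S) {e f : Idem S} (h : e ≤ f) : conj s e ≤ conj s f := by
  rw [Idem.le_iff] at h ⊢
  simp only [coe_conj]
  have hc := idem_commute (isIdempotentElem_inv_mul s) f.2
  calc s * e * s⁻¹ = s * (f * e) * s⁻¹ := by rw [← h]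
    _ = s * (s⁻¹ * s * f) * e * s⁻¹ := by
      rw [← mul_assoc s (s⁻¹ * s), mul_inv_mul_self', mul_assoc s f e]
    _ = _ := by rw [hc]; simp only [mul_assoc]

/-- The domain idempotent of an element. -/
def dom (s : S) : Idem S := ⟨s⁻¹ * s, isIdempotentElem_inv_mul s⟩

/-- The range idempotent of an element. -/
def ran (s : S) : Idem S := ⟨s * s⁻¹, isIdempotentElem_mul_inv s⟩

theorem conj_inv_conj (s : S) (e : Idem S) : conj s⁻¹ (conj s e) = dom s ⊓ e := by
  rw [← conj_mul]
  exact conj_idem (dom s) e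

theorem mul_dom (s : S) : s * (dom s : S) = s := mul_inv_mul_self' s

/-- The conjugation action of the units on the idempotents. -/
def unitsConj : Sˣ →* (Idem S ≃o Idem S) where
  toFun g :=
    { toFun := conj (g : S)
      invFun := conj ((g⁻¹ : Sˣ) : S)
      left_inv := fun e => by rw [← conj_mul, Units.inv_mul, conj_one]
      right_inv := fun e => by rw [← conj_mul, Units.mul_inv, conj_one]
      map_rel_iff' := fun {a b} => by
        refine ⟨fun h => ?_, fun h => conj_mono _ h⟩
        have := conj_mono ((g⁻¹ : Sˣ) : S) h
        simpa only [Equiv.coe_fn_mk, ← conj_mul, Units.inv_mul, conj_one] using this }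
  map_one' := RelIso.ext fun e => conj_one e
  map_mul' g h := RelIso.ext fun e => conj_mul _ _ e

theorem unitsConj_apply (g : Sˣ) (e : Idem S) : unitsConj g e = conj (g : S) e := rfl

/-- An element with disjoint domain and range extends to a unit of order two which is the
identity elsewhere. -/
theorem exists_involution (a : S) (h : Disjoint (dom a) (ran a)) :
    ∃ g : Sˣ, g * g = 1 ∧ (g : S) * dom a = a ∧
      ∀ x : Idem S, Disjoint x (dom a ⊔ ran a) → (g : S) * x = x := by
  set e : Idem S := (dom a ⊔ ran a)ᶜ with he
  have hd := isDistributive (S := S)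
  -- The involution will be `a ∨ a⁻¹ ∨ e`; the vanishing products show that these pieces are
  -- compatible.
  have haa : a * a = 0 := by
    have h1 := Idem.disjoint_iff.1 h
    calc a * a = a * (dom a : S) * ((ran a : S) * a) := by
          rw [mul_dom, show (ran a : S) * a = a from mul_inv_mul_self a]
      _ = a * (dom a * ran a : S) * a := by simp only [mul_assoc]
      _ = 0 := by rw [h1]; simp
  have haa' : a⁻¹ * a⁻¹ = 0 := by
    rw [← inv_mul_rev, haa, idem_inv IsIdempotentElem.zero]
  have hdom : Disjoint e (dom a) := disjoint_compl_left.mono_right le_sup_left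
  have hran : Disjoint e (ran a) := disjoint_compl_left.mono_right le_sup_right
  have hea : (e : S) * a = 0 := by
    rw [← mul_inv_mul_self a, ← mul_assoc]
    change (e : S) * (ran a : S) * a = 0
    rw [Idem.disjoint_iff.1 hran, zero_mul]
  have hea' : (e : S) * a⁻¹ = 0 := by
    rw [← inv_mul_inv_self a, ← mul_assoc]
    change (e : S) * (dom a : S) * a⁻¹ = 0
    rw [Idem.disjoint_iff.1 hdom, zero_mul]
  obtain ⟨j, hj⟩ := hd.exists_join a a⁻¹ (by
    rw [compatible_iff, inv_inv_self, haa, haa']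
    exact ⟨IsIdempotentElem.zero, IsIdempotentElem.zero⟩)
  have hae : a * (e : S) = 0 := by
    rw [← mul_dom a, mul_assoc, Idem.disjoint_iff.1 hdom.symm, mul_zero]
  have hae' : a⁻¹ * (e : S) = 0 := by
    rw [← inv_mul_inv_self a, mul_assoc a⁻¹, mul_assoc a⁻¹]
    change a⁻¹ * ((ran a : S) * e) = 0
    rw [Idem.disjoint_iff.1 hran.symm, mul_zero]
  have hje : j * (e : S) = 0 := by
    have := hd.join_mul _ _ _ (e : S) hj
    rw [hae, hae'] at this
    exact this.unique (isJoin_zero_left 0)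
  have hej : (e : S) * j = 0 := by
    have := hd.mul_join _ _ _ (e : S) hj
    rw [hea, hea'] at this
    exact this.unique (isJoin_zero_left 0)
  obtain ⟨g, hg⟩ := hd.exists_join j e (by
    rw [compatible_iff, idem_inv e.2, hje]
    refine ⟨IsIdempotentElem.zero, ?_⟩
    rw [← idem_inv e.2, ← inv_mul_rev, hej, idem_inv IsIdempotentElem.zero]
    exact IsIdempotentElem.zero)
  have hga : g * a = dom a := by
    have h1 := hd.join_mul _ _ _ a hg
    rw [hea] at h1
    have h2 := hd.join_mul _ _ _ a hj
    rw [haa] at h2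
    rw [h1.unique (isJoin_zero_right _), h2.unique (isJoin_zero_left _)]
    rfl
  have hga' : g * a⁻¹ = ran a := by
    have h1 := hd.join_mul _ _ _ a⁻¹ hg
    rw [hea'] at h1
    have h2 := hd.join_mul _ _ _ a⁻¹ hj
    rw [haa'] at h2
    rw [h1.unique (isJoin_zero_right _), h2.unique (isJoin_zero_right _)]
    rfl
  have hge : g * e = e := by
    have h1 := hd.join_mul _ _ _ (e : S) hg
    rw [hje, idem_mul_self e.2] at h1
    exact h1.unique (isJoin_zero_left _)
  have hgj : g * j = (dom a ⊔ ran a : Idem S) := by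
    have h1 := hd.mul_join _ _ _ g hj
    rw [hga, hga'] at h1
    exact h1.unique (Idem.isJoin_sup _ _)
  have hgg : g * g = 1 := by
    have h1 := hd.mul_join _ _ _ g hg
    rw [hgj, hge] at h1
    rw [h1.unique (Idem.isJoin_sup _ _), he, sup_compl_eq_top, Idem.coe_top]
  refine ⟨⟨g, g, hgg, hgg⟩, Units.ext hgg, ?_, fun x hx => ?_⟩
  · change g * (a⁻¹ * a) = a
    rw [← mul_assoc, hga']
    exact mul_inv_mul_self a
  · have hxe : x ≤ e := le_compl_iff_disjoint_right.2 hx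
    rw [Idem.le_iff] at hxe
    change g * x = x
    rw [hxe, ← mul_assoc, hge]

/-! ### Congruence-freeness makes the unit group vigorous -/

namespace IsCongruenceFree

/-- The Rees congruence of the ideal generated by `e` identifies `e` with `0`, so it is universal
and `1 = a e b` for some `a, b`. Then `e b` has a left inverse, so its domain is `⊤`. -/
theorem exists_dom_eq_top (h : IsCongruenceFree S) {e : Idem S} (he : e ≠ ⊥) :
    ∃ s : S, dom s = ⊤ ∧ ran s ≤ e := by
  let I : Set S := {x | ∃ a b, x = a * e * b}
  have hl : ∀ c x, x ∈ I → c * x ∈ I := by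
    rintro c _ ⟨a, b, rfl⟩
    exact ⟨c * a, b, by simp only [mul_assoc]⟩
  have hr : ∀ c x, x ∈ I → x * c ∈ I := by
    rintro c _ ⟨a, b, rfl⟩
    exact ⟨a, b * c, by simp only [mul_assoc]⟩
  let c : Con S :=
    { r := fun x y => x = y ∨ (x ∈ I ∧ y ∈ I)
      iseqv := ⟨fun x => Or.inl rfl, fun h => h.imp Eq.symm And.symm, fun {x y z} h h' => by
        rcases h with rfl | h
        · exact h'
        · rcases h' with rfl | h'
          · exact Or.inr h
          · exact Or.inr ⟨h.1, h'.2⟩⟩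
      mul' := fun {w x y z} h h' => by
        rcases h with rfl | h
        · rcases h' with rfl | h'
          · exact Or.inl rfl
          · exact Or.inr ⟨hl _ _ h'.1, hl _ _ h'.2⟩
        · exact Or.inr ⟨hr _ _ h.1, hr _ _ h.2⟩ }
  have h0 : (0 : S) ∈ I := ⟨0, 0, by simp⟩
  rcases h.eq_or_forall c with h1 | h1
  · exact absurd (Idem.eq_bot_iff.2 (h1 (e : S) 0 (Or.inr ⟨⟨1, 1, by simp⟩, h0⟩))) he
  · rcases h1 0 1 with h2 | ⟨-, a, b, hab⟩
    · exact absurd h2 h.zero_ne_one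
    · refine ⟨e * b, ?_, ?_⟩
      · apply Subtype.ext
        rw [Idem.coe_top]
        change (e * b : S)⁻¹ * (e * b) = 1
        set y := (e : S) * b with hy
        have h3 : a * y = 1 := by rw [hab, hy, mul_assoc]
        calc y⁻¹ * y = a * y * (y⁻¹ * y) := by rw [h3, one_mul]
          _ = a * (y * (y⁻¹ * y)) := mul_assoc _ _ _
          _ = 1 := by rw [mul_inv_mul_self', h3]
      · rw [Idem.le_iff]
        change (e * b * (e * b)⁻¹ : S) = e * (e * b * (e * b)⁻¹)
        simp only [mul_assoc, idem_mul_assoc e.2]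

/-- Having the same conjugation action is a congruence which separates `0` from `1`, hence is
equality. -/
theorem ext_conj (h : IsCongruenceFree S) {s t : S} (hst : ∀ e, conj s e = conj t e) :
    s = t := by
  let c : Con S :=
    { r := fun x y => ∀ e, conj x e = conj y e
      iseqv := ⟨fun x e => rfl, fun h e => (h e).symm, fun h h' e => (h e).trans (h' e)⟩
      mul' := fun {w x y z} h h' e => by rw [conj_mul, conj_mul, h', h] }
  rcases h.eq_or_forall c with h1 | h1
  · exact h1 s t hst
  · exfalso
    have h2 := congrArg Subtype.val (h1 0 1 ⊤)
    rw [conj_one, coe_conj, Idem.coe_top, zero_mul, zero_mul] at h2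
    exact h.zero_ne_one h2

/-- If `e` were an atom, conjugation by an element squeezing `1` into `e` would embed all
idempotents into `{⊥, e}`. Then there are finitely many conjugation maps, and by `ext_conj` finitely
many elements. -/
theorem exists_lt (h : IsCongruenceFree S) [Infinite S] (e : Idem S) (he : e ≠ ⊥) :
    ∃ f, f ≠ ⊥ ∧ f < e := by
  by_contra! hc
  have hat : ∀ f ≤ e, f = ⊥ ∨ f = e := by
    intro f hf
    by_contra! h1
    exact hc f h1.1 (lt_of_le_of_ne hf h1.2)
  obtain ⟨a, ha, hae⟩ := h.exists_dom_eq_top he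
  have hle : ∀ x, conj a x ≤ e := fun x => (conj_mono a le_top).trans (le_trans (le_of_eq (by
    apply Subtype.ext
    rw [coe_conj, Idem.coe_top, mul_one]; rfl)) hae)
  have hinj : Function.Injective (conj a) := by
    intro x y hxy
    have := congrArg (conj a⁻¹) hxy
    simpa only [conj_inv_conj, ha, top_inf_eq] using this
  have h2 : ∀ x : Idem S, x = ⊥ ∨ x = ⊤ := by
    have hb : conj a ⊥ = ⊥ := by
      rw [Idem.eq_bot_iff, coe_conj, Idem.coe_bot, mul_zero, zero_mul]
    intro x
    rcases hat _ (hle x) with h3 | h3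
    · exact Or.inl (hinj (h3.trans hb.symm))
    · rcases hat _ (hle ⊤) with h4 | h4
      · have : (⊤ : Idem S) = ⊥ := hinj (h4.trans hb.symm)
        exact Or.inl (le_bot_iff.1 (this ▸ le_top))
      · exact Or.inr (hinj (h3.trans h4.symm))
  have hfin : Finite (Idem S) := by
    refine Set.finite_univ_iff.1 ((Set.toFinite {⊥, ⊤}).subset fun x _ => ?_)
    simpa using h2 x
  have : Finite S := Finite.of_injective (fun s : S => conj s) fun s t hst =>
    h.ext_conj fun e => congrFun hst e
  exact not_finite S

theorem isVigorous (h : IsCongruenceFree S) [Infinite S] :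
    IsVigorous (unitsConj : Sˣ →* (Idem S ≃o Idem S)) where
  injective g k hgk := Units.ext (h.ext_conj fun e => by
    rw [← unitsConj_apply, hgk, unitsConj_apply])
  exists_swap u v huv hv := by
    obtain ⟨s, hs, hsv⟩ := h.exists_dom_eq_top hv
    have hdom : dom (s * u) = u := by
      apply Subtype.ext
      change (s * u : S)⁻¹ * (s * u) = u
      have hs' : s⁻¹ * s = 1 := by rw [← Idem.coe_top, ← hs]; rfl
      rw [inv_mul_rev, idem_inv u.2, mul_assoc, ← mul_assoc s⁻¹, hs', one_mul, idem_mul_self u.2]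
    have hran : ran (s * u) ≤ v := by
      refine le_trans ?_ hsv
      rw [Idem.le_iff]
      change (s * u * (s * u)⁻¹ : S) = s * s⁻¹ * (s * u * (s * u)⁻¹)
      simp only [mul_assoc, mul_inv_mul_assoc]
    have hconj : conj (s * u) u = ran (s * u) := by
      apply Subtype.ext
      change s * u * u * (s * u)⁻¹ = s * u * (s * u)⁻¹
      rw [mul_assoc s, idem_mul_self u.2]
    -- `s` squeezes `1` into `v`, so `s * u` has domain `u` and range below `v`; disjointness lets
    -- it extend to a unit.
    obtain ⟨g, hgg, hg, hfix⟩ := exists_involution (s * u) (by rw [hdom]; exact huv.mono_right hran)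
    rw [hdom] at hg hfix
    have hgu : conj (g : S) u = ran (s * u) := by
      rw [← hconj, ← hg, conj_mul, conj_idem, inf_idem]
    refine ⟨g, ?_, ?_, fun x hx => ?_⟩
    · rw [unitsConj_apply, hgu]
      exact hran
    · rw [← map_mul_apply, hgg, map_one]; rfl
    · rw [unitsConj_apply, hgu] at hx
      have := hfix x hx
      rw [unitsConj_apply]
      have h2 : conj (g * x : S) x = conj (g : S) x := by rw [conj_mul, conj_idem, inf_idem]
      rw [← h2, this, conj_idem, inf_idem]
  exists_lt := h.exists_lt
  exists_support g := by
    -- `g ∧ 1` is the largest idempotent on which `g` restricts to the identity; its complement is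
    -- the support.
    obtain ⟨m, hmg, hm1, hm⟩ := exists_meet (g : S) 1
    let m' : Idem S := ⟨m, hm1.isIdempotentElem IsIdempotentElem.one⟩
    refine ⟨m'ᶜ, fun b => ?_⟩
    rw [compl_le_iff_compl_le]
    constructor
    · intro hb
      rw [le_iff_natLE]
      refine hm _ ⟨_, bᶜ.2, ?_⟩ (IsIdempotentElem.natLE_one bᶜ.2)
      refine h.ext_conj fun x => ?_
      rw [conj_mul, conj_idem]
      exact (hb _ (disjoint_compl_left.mono_left inf_le_left)).symm
    · intro hb x hx
      have h1 : x ≤ m' := (le_compl_iff_disjoint_right.2 hx).trans hb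
      rw [le_iff_natLE] at h1
      have h2 : (x : S) = g * x := (natLE_idem_iff x.2).1 (h1.trans hmg)
      have h3 : conj (g * x : S) x = conj (g : S) x := by rw [conj_mul, conj_idem, inf_idem]
      rw [unitsConj_apply, ← h3, ← h2, conj_idem, inf_idem]

end IsCongruenceFree

end BooleanInverseMonoid

/-! ### Extending an isomorphism of unit groups to the monoids -/

section Extension

open InverseMonoid BooleanInverseMonoid

variable {S : Type u} [MonoidWithZero S] [BooleanInverseMonoid S]

theorem compatible_of_natLE {a b j : S} (ha : NatLE a j) (hb : NatLE b j) : Compatible a b := by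
  rw [compatible_iff]
  constructor
  · obtain ⟨e, he, rfl⟩ := ha
    obtain ⟨f, hf, rfl⟩ := hb
    rw [inv_mul_rev, idem_inv hf, ← mul_assoc, mul_assoc j]
    exact isIdempotentElem_conj j (isIdempotentElem_mul he hf)
  · rw [ha.eq_mul', hb.eq_mul', inv_mul_rev, idem_inv (isIdempotentElem_mul_inv a), mul_assoc,
      ← mul_assoc (a * a⁻¹), ← mul_assoc]
    exact isIdempotentElem_conj' j (isIdempotentElem_mul (isIdempotentElem_mul_inv a)
      (isIdempotentElem_mul_inv b))

theorem IsJoin.inv {a b j : S} (h : IsJoin a b j) : IsJoin a⁻¹ b⁻¹ j⁻¹ := by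
  refine ⟨h.1.inv, h.2.1.inv, fun c hac hbc => ?_⟩
  have h1 := hac.inv
  have h2 := hbc.inv
  rw [inv_inv_self] at h1 h2
  have h3 := (h.2.2 _ h1 h2).inv
  rwa [inv_inv_self] at h3

/-- For `x ≤ j` one has `x e j⁻¹ = x e x⁻¹`, so distributing `(a ∨ b) e j⁻¹` produces no mixed
terms. -/
theorem IsJoin.conj {a b j : S} (h : IsJoin a b j) (e : Idem S) :
    BooleanInverse.conj j e = BooleanInverse.conj a e ⊔ BooleanInverse.conj b e := by
  have key : ∀ {x : S}, NatLE x j → x * e * j⁻¹ = x * e * x⁻¹ := by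
    intro x hx
    conv_rhs => rw [hx.eq_mul]
    rw [inv_mul_rev, idem_inv (isIdempotentElem_inv_mul x)]
    have hc := idem_commute e.2 (isIdempotentElem_inv_mul x)
    have h1 : x = j * (x⁻¹ * x) := hx.eq_mul
    calc x * e * j⁻¹ = x * (x⁻¹ * x) * e * j⁻¹ := by rw [mul_inv_mul_self']
      _ = x * ((e : S) * (x⁻¹ * x)) * j⁻¹ := by rw [hc]; simp only [mul_assoc]
      _ = x * e * (x⁻¹ * x * j⁻¹) := by simp only [mul_assoc]
      _ = _ := by rw [← h1]
  have hd := isDistributive (S := S)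
  have h1 := hd.join_mul _ _ _ j⁻¹ (hd.join_mul _ _ _ (e : S) h)
  rw [key h.1, key h.2.1] at h1
  exact Subtype.ext (h1.unique (Idem.isJoin_sup (BooleanInverse.conj a e)
    (BooleanInverse.conj b e)))

/-- An element whose domain and range do not cover everything is a restriction of a unit. -/
theorem IsCongruenceFree.exists_unit_mul_dom (h : IsCongruenceFree S) {a : S} {w : Idem S}
    (hw : w ≠ ⊥) (hd : dom a ≤ wᶜ) (hr : ran a ≤ wᶜ) : ∃ g : Sˣ, a = g * dom a := by
  obtain ⟨s, hs, hsw⟩ := h.exists_dom_eq_top hw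
  have hs1 : s⁻¹ * s = 1 := by rw [← Idem.coe_top, ← hs]; rfl
  have hs2 : ∀ z, s⁻¹ * (s * z) = z := fun z => by rw [← mul_assoc, hs1, one_mul]
  have hsw' : ∀ x : Idem S, (s * x * s⁻¹ : S) = w * (s * x * s⁻¹) := by
    intro x
    have h1 := Idem.le_iff.1 hsw
    calc (s * x * s⁻¹ : S) = (ran s : S) * (s * x * s⁻¹) := by
          change _ = s * s⁻¹ * (s * x * s⁻¹)
          simp only [mul_assoc, mul_inv_mul_assoc]
      _ = _ := by
          conv_lhs => rw [h1]
          change w * (s * s⁻¹) * (s * x * s⁻¹) = _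
          simp only [mul_assoc, mul_inv_mul_assoc]
  have hdw : Disjoint (dom a) w := le_compl_iff_disjoint_right.1 hd
  have hrw : Disjoint w (ran a) := (le_compl_iff_disjoint_right.1 hr).symm
  -- Domain and range of `a` may overlap, so `a = q p` is factored through the free space `w`; `p`
  -- and `q` each have disjoint domain and range and extend to units.
  let p : S := s * dom a
  let q : S := a * s⁻¹
  have hpd : dom p = dom a := by
    apply Subtype.ext
    change (s * (dom a : S))⁻¹ * (s * (dom a : S)) = dom a
    rw [inv_mul_rev, idem_inv (dom a).2, mul_assoc, hs2, idem_mul_self (dom a).2]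
  have hpr : ran p ≤ w := by
    rw [Idem.le_iff]
    change s * (dom a : S) * (s * (dom a : S))⁻¹ = w * (s * (dom a : S) * (s * (dom a : S))⁻¹)
    rw [inv_mul_rev, idem_inv (dom a).2, ← mul_assoc, mul_assoc s, idem_mul_self (dom a).2]
    exact hsw' _
  have hqd : dom q ≤ w := by
    rw [Idem.le_iff]
    change (a * s⁻¹)⁻¹ * (a * s⁻¹) = w * ((a * s⁻¹)⁻¹ * (a * s⁻¹))
    rw [inv_mul_rev, inv_inv_self,
      show s * a⁻¹ * (a * s⁻¹) = s * (dom a : S) * s⁻¹ by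
        change _ = s * (a⁻¹ * a) * s⁻¹
        simp only [mul_assoc]]
    exact hsw' _
  have hqr : ran q = ran a := by
    apply Subtype.ext
    change a * s⁻¹ * (a * s⁻¹)⁻¹ = a * a⁻¹
    rw [inv_mul_rev, inv_inv_self, mul_assoc, hs2]
  obtain ⟨g, -, hg, -⟩ := exists_involution p (by rw [hpd]; exact hdw.mono_right hpr)
  obtain ⟨k, -, hk, -⟩ := exists_involution q (by rw [hqr]; exact hrw.mono_left hqd)
  have hqp : q * p = a := by
    change a * s⁻¹ * (s * dom a) = a
    rw [mul_assoc, hs2, mul_dom]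
  have hdqp : (dom q : S) * p = p := by
    change (a * s⁻¹)⁻¹ * (a * s⁻¹) * (s * (a⁻¹ * a)) = s * (a⁻¹ * a)
    rw [inv_mul_rev, inv_inv_self]
    simp only [mul_assoc, hs2, inv_mul_inv_assoc]
  refine ⟨k * g, ?_⟩
  rw [hpd] at hg
  rw [Units.val_mul, mul_assoc, hg]
  calc a = q * p := hqp.symm
    _ = k * (dom q : S) * p := by rw [hk]
    _ = _ := by rw [mul_assoc, hdqp]

/-- Three pieces are used so that every corner `u i * s * u j` avoids a third piece, the free space
required by `exists_unit_mul_dom`. -/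
theorem IsCongruenceFree.exists_partition (h : IsCongruenceFree S) [Infinite S] :
    ∃ u : Fin 3 → Idem S, (∀ i, u i ≠ ⊥) ∧ (∀ i j, i ≠ j → Disjoint (u i) (u j)) ∧
      u 0 ⊔ u 1 ⊔ u 2 = ⊤ := by
  have ht : (⊤ : Idem S) ≠ ⊥ := by
    rw [Ne, Idem.eq_bot_iff, Idem.coe_top]
    exact h.zero_ne_one.symm
  obtain ⟨w, hw, hwt⟩ := h.exists_lt ⊤ ht
  obtain ⟨p, hp, hpw⟩ := h.exists_lt w hw
  have h01 : Disjoint p (w \ p) := disjoint_sdiff_self_right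
  have h02 : Disjoint p wᶜ := disjoint_compl_right.mono_left hpw.le
  have h12 : Disjoint (w \ p) wᶜ := disjoint_compl_right.mono_left sdiff_le
  refine ⟨![p, w \ p, wᶜ], ?_, ?_, ?_⟩
  · intro i
    fin_cases i
    · exact hp
    · change w \ p ≠ ⊥
      rw [Ne, sdiff_eq_bot_iff]; exact hpw.not_ge
    · change wᶜ ≠ ⊥
      rw [Ne, compl_eq_bot]; exact hwt.ne
  · intro i j hij
    fin_cases i <;> fin_cases j <;> first | exact absurd rfl hij | skip
    exacts [h01, h02, h01.symm, h12, h02.symm, h12.symm]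
  · change p ⊔ w \ p ⊔ wᶜ = ⊤
    rw [sup_sdiff_cancel_right hpw.le, sup_compl_eq_top]

/-- Induction principle: restrictions of units generate everything under binary joins. -/
theorem IsCongruenceFree.induction (h : IsCongruenceFree S) [Infinite S] {P : S → Prop}
    (hunit : ∀ (g : Sˣ) (e : Idem S), P (g * e))
    (hjoin : ∀ a b j, IsJoin a b j → P a → P b → P j) (s : S) : P s := by
  obtain ⟨u, hu, hd, ht⟩ := h.exists_partition
  have hdis := isDistributive (S := S)
  have hpiece : ∀ i j, P (u i * s * u j) := by
    intro i j
    have hk : ∃ k, k ≠ i ∧ k ≠ j := by revert i j; decide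
    obtain ⟨k, hki, hkj⟩ := hk
    have h1 : dom (u i * s * u j) ≤ (u k)ᶜ := by
      refine le_trans ?_ (le_compl_iff_disjoint_right.2 (hd j k hkj.symm))
      rw [Idem.le_iff]
      change (u i * s * u j : S)⁻¹ * (u i * s * u j) = u j * ((u i * s * u j : S)⁻¹ * (u i * s * u j))
      rw [inv_mul_rev, idem_inv (u j).2]
      simp only [mul_assoc, idem_mul_assoc (u j).2]
    have h2 : ran (u i * s * u j) ≤ (u k)ᶜ := by
      refine le_trans ?_ (le_compl_iff_disjoint_right.2 (hd i k hki.symm))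
      rw [Idem.le_iff]
      change (u i * s * u j : S) * (u i * s * u j : S)⁻¹ =
        u i * ((u i * s * u j) * (u i * s * u j : S)⁻¹)
      simp only [mul_assoc, idem_mul_assoc (u i).2]
    obtain ⟨g, hg⟩ := h.exists_unit_mul_dom (hu k) h1 h2
    rw [hg]
    exact hunit _ _
  have hrow : ∀ i, P (u i * s) := by
    intro i
    have h1 := hdis.mul_join _ _ _ (u i * s : S) (Idem.isJoin_sup (u 0) (u 1))
    have h2 := hdis.mul_join _ _ _ (u i * s : S) (Idem.isJoin_sup (u 0 ⊔ u 1) (u 2))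
    rw [ht, Idem.coe_top, mul_one] at h2
    exact hjoin _ _ _ h2 (hjoin _ _ _ h1 (hpiece i 0) (hpiece i 1)) (hpiece i 2)
  have h1 := hdis.join_mul _ _ _ s (Idem.isJoin_sup (u 0) (u 1))
  have h2 := hdis.join_mul _ _ _ s (Idem.isJoin_sup (u 0 ⊔ u 1) (u 2))
  rw [ht, Idem.coe_top, one_mul] at h2
  exact hjoin _ _ _ h2 (hjoin _ _ _ h1 (hrow 0) (hrow 1)) (hrow 2)

variable {T : Type v} [MonoidWithZero T] [BooleanInverseMonoid T]

/-- `s` and `t` act in the same way on idempotents identified by `β`. -/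
def Corresponds (β : Idem S ≃o Idem T) (s : S) (t : T) : Prop :=
  (∀ e, β (conj s e) = conj t (β e)) ∧ ∀ e, β (conj s⁻¹ e) = conj t⁻¹ (β e)

namespace Corresponds

variable {β : Idem S ≃o Idem T} {s s' : S} {t t' : T}

theorem mul (h : Corresponds β s t) (h' : Corresponds β s' t') :
    Corresponds β (s * s') (t * t') := by
  refine ⟨fun e => ?_, fun e => ?_⟩
  · rw [conj_mul, conj_mul, h.1, h'.1]
  · rw [inv_mul_rev, inv_mul_rev, conj_mul, conj_mul, h'.2, h.2]

theorem inv (h : Corresponds β s t) : Corresponds β s⁻¹ t⁻¹ :=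
  ⟨h.2, by rw [inv_inv_self, inv_inv_self]; exact h.1⟩

theorem symm (h : Corresponds β s t) : Corresponds β.symm t s := by
  refine ⟨fun e => ?_, fun e => ?_⟩
  · rw [β.symm_apply_eq, h.1, β.apply_symm_apply]
  · rw [β.symm_apply_eq, h.2, β.apply_symm_apply]

theorem right_unique (hT : IsCongruenceFree T) (h : Corresponds β s t)
    (h' : Corresponds β s t') : t = t' := by
  refine hT.ext_conj fun e => ?_
  obtain ⟨e, rfl⟩ := β.surjective e
  rw [← h.1, ← h'.1]

theorem left_unique (hS : IsCongruenceFree S) (h : Corresponds β s t)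
    (h' : Corresponds β s' t) : s = s' :=
  right_unique hS h.symm h'.symm

theorem idem (β : Idem S ≃o Idem T) (e : Idem S) : Corresponds β (e : S) (β e : T) := by
  refine ⟨fun f => ?_, fun f => ?_⟩
  · rw [conj_idem, conj_idem, β.map_inf]
  · rw [idem_inv e.2, idem_inv (β e).2, conj_idem, conj_idem, β.map_inf]

theorem isIdempotentElem (hT : IsCongruenceFree T) (h : Corresponds β s t)
    (hs : IsIdempotentElem s) : IsIdempotentElem t := by
  have h1 := h.mul h
  rw [idem_mul_self hs] at h1
  exact right_unique hT h1 h

/-- Correspondence respects products and inverses and takes idempotents to idempotents, so `a'` and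
`b'` are again compatible; their join corresponds to `j` by `IsJoin.conj`. -/
theorem exists_join (hT : IsCongruenceFree T) {a b j : S} {a' b' : T} (hj : IsJoin a b j)
    (ha : Corresponds β a a') (hb : Corresponds β b b') : ∃ j', Corresponds β j j' := by
  have hc := compatible_iff.1 (compatible_of_natLE hj.1 hj.2.1)
  obtain ⟨j', hj'⟩ := (isDistributive (S := T)).exists_join a' b' (compatible_iff.2
    ⟨(ha.mul hb.inv).isIdempotentElem hT hc.1, (ha.inv.mul hb).isIdempotentElem hT hc.2⟩)
  refine ⟨j', fun e => ?_, fun e => ?_⟩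
  · rw [hj.conj, hj'.conj, β.map_sup, ha.1, hb.1]
  · rw [hj.inv.conj, hj'.inv.conj, β.map_sup, ha.2, hb.2]

theorem exists_right (hS : IsCongruenceFree S) (hT : IsCongruenceFree T) [Infinite S]
    (φ : Sˣ ≃* Tˣ) (hβ : ∀ g x, β (unitsConj g x) = unitsConj (φ g) (β x)) (s : S) :
    ∃ t, Corresponds β s t := by
  refine hS.induction (P := fun s => ∃ t, Corresponds β s t) (fun g e => ?_) ?_ s
  · have hg : Corresponds β (g : S) (φ g : T) := by
      refine ⟨hβ g, ?_⟩
      rw [coe_units_inv, coe_units_inv, ← map_inv]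
      exact hβ g⁻¹
    exact ⟨_, hg.mul (idem β e)⟩
  · rintro a b j hj ⟨a', ha⟩ ⟨b', hb⟩
    exact ha.exists_join hT hj hb

end Corresponds

/-- Existence of correspondents in both directions makes the relation a bijection; uniqueness makes
it multiplicative. -/
theorem nonempty_mulEquiv (hS : IsCongruenceFree S) (hT : IsCongruenceFree T) [Infinite S]
    [Infinite T] (φ : Sˣ ≃* Tˣ) : Nonempty (S ≃* T) := by
  obtain ⟨β, hβ⟩ := hS.isVigorous.exists_orderIso hT.isVigorous φ
  have hβ' : ∀ g x, β.symm (unitsConj g x) = unitsConj (φ.symm g) (β.symm x) := fun g x => by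
    rw [β.symm_apply_eq, hβ, β.apply_symm_apply, φ.apply_symm_apply]
  choose F hF using Corresponds.exists_right hS hT φ hβ
  have hsymm := Corresponds.exists_right hT hS φ.symm hβ'
  refine ⟨MulEquiv.ofBijective (⟨F, fun s s' => ?_⟩ : S →ₙ* T) ⟨fun s s' hss => ?_, fun t => ?_⟩⟩
  · exact Corresponds.right_unique hT (hF _) ((hF s).mul (hF s'))
  · have hss : F s = F s' := hss
    have h' := hF s'
    rw [← hss] at h'
    exact Corresponds.left_unique hS (hF s) h'
  · obtain ⟨s, hs⟩ := hsymm t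
    have := hs.symm
    rw [OrderIso.symm_symm] at this
    exact ⟨s, Corresponds.right_unique hT (hF s) this⟩

end Extension

theorem exists_pequiv {α : Type u} {R : α → α → Prop}
    (hr : ∀ a b b', R a b → R a b' → b = b') (hl : ∀ a a' b, R a b → R a' b → a = a') :
    ∃ f : α ≃. α, ∀ a b, b ∈ f a ↔ R a b := by
  classical
  have key : ∀ {R : α → α → Prop}, (∀ a b b', R a b → R a b' → b = b') →
      ∀ a b, (if h : ∃ b, R a b then some h.choose else none) = some b ↔ R a b := by
    intro R hR a b
    split_ifs with h
    · rw [Option.some_inj]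
      exact ⟨fun hb => hb ▸ h.choose_spec, fun hb => hR a _ _ h.choose_spec hb⟩
    · exact iff_of_false (by simp) fun hb => h ⟨b, hb⟩
  exact ⟨⟨fun a => if h : ∃ b, R a b then some h.choose else none,
    fun b => if h : ∃ a, R a b then some h.choose else none, fun a b =>
      (key (R := fun b a => R a b) (fun b a a' => hl a a' b) b a).trans (key hr a b).symm⟩,
    key hr⟩

/-! ### The Cuntz inverse monoid through graphs of partial maps -/

namespace CuntzMonoid

variable {n : ℕ}

/-- The graph of an element of the Cuntz inverse monoid. -/
def Rel (f : CuntzMonoid n) (w v : Stream' (Fin n)) : Prop := v ∈ f.1 w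

theorem ext_rel {f g : CuntzMonoid n} (h : ∀ w v, f.Rel w v ↔ g.Rel w v) : f = g :=
  Subtype.ext (PEquiv.ext fun w => Option.ext fun v => h w v)

theorem rel_mul {f g : CuntzMonoid n} {w v : Stream' (Fin n)} :
    (f * g).Rel w v ↔ ∃ u, g.Rel w u ∧ f.Rel u v := PEquiv.mem_trans g.1 f.1 w v

theorem rel_one {w v : Stream' (Fin n)} : (1 : CuntzMonoid n).Rel w v ↔ w = v :=
  Option.mem_some_iff

theorem not_rel_zero {w v : Stream' (Fin n)} : ¬(0 : CuntzMonoid n).Rel w v :=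
  fun h => by cases h

theorem Rel.right_unique {f : CuntzMonoid n} {w v v' : Stream' (Fin n)} (h : f.Rel w v)
    (h' : f.Rel w v') : v = v' := Option.mem_unique h h'

theorem Rel.left_unique {f : CuntzMonoid n} {w w' v : Stream' (Fin n)} (h : f.Rel w v)
    (h' : f.Rel w' v) : w = w' := f.1.inj h h'

/-- `R` is, on cylinders of depth `N`, nowhere defined or a prefix replacement. -/
def IsLocalAt (R : Stream' (Fin n) → Stream' (Fin n) → Prop) (N : ℕ) : Prop :=
  ∀ x : List (Fin n), x.length = N →
    (∀ t v, ¬R (x ++ₛ t) v) ∨ ∃ y : List (Fin n), ∀ t, R (x ++ₛ t) (y ++ₛ t)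

/-- Allowing every larger depth lets several elements be examined on the same cylinders. -/
theorem exists_isLocalAt (f : CuntzMonoid n) : ∃ N, ∀ M, N ≤ M → IsLocalAt f.Rel M := by
  obtain ⟨N, hN⟩ := (hasTable_iff f.1).1 f.2
  refine ⟨N, fun M hNM x hx => ?_⟩
  have hs : ∀ t, x ++ₛ t = x.take N ++ₛ (x.drop N ++ₛ t) := fun t => by
    rw [← Stream'.append_append_stream, List.take_append_drop]
  rcases hN (x.take N) (by rw [List.length_take]; omega) with h | ⟨y, h⟩
  · left
    intro t v hv
    rw [hs, Rel, h] at hv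
    cases hv
  · right
    refine ⟨y ++ x.drop N, fun t => ?_⟩
    rw [hs, Rel, h, Stream'.append_append_stream]
    rfl

theorem exists_of_isLocalAt {R : Stream' (Fin n) → Stream' (Fin n) → Prop}
    (hr : ∀ a b b', R a b → R a b' → b = b') (hl : ∀ a a' b, R a b → R a' b → a = a')
    {N : ℕ} (h : IsLocalAt R N) : ∃ f : CuntzMonoid n, ∀ w v, f.Rel w v ↔ R w v := by
  obtain ⟨f, hf⟩ := exists_pequiv hr hl
  refine ⟨⟨f, (hasTable_iff f).2 ⟨N, fun x hx => ?_⟩⟩, hf⟩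
  rcases h x hx with h | ⟨y, h⟩
  · left
    intro t
    rw [Option.eq_none_iff_forall_not_mem]
    exact fun v hv => h t v ((hf _ _).1 hv)
  · exact Or.inr ⟨y, fun t => (hf _ _).2 (h t)⟩

theorem exists_isLocalAt_two (f g : CuntzMonoid n) :
    ∃ N, IsLocalAt f.Rel N ∧ IsLocalAt g.Rel N := by
  obtain ⟨N, hN⟩ := exists_isLocalAt f
  obtain ⟨M, hM⟩ := exists_isLocalAt g
  exact ⟨max N M, hN _ (le_max_left _ _), hM _ (le_max_right _ _)⟩

/-- The inverse partial bijection. -/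
def symm (f : CuntzMonoid n) : CuntzMonoid n := ⟨f.1.symm, f.2.symm⟩

theorem rel_symm {f : CuntzMonoid n} {w v : Stream' (Fin n)} : f.symm.Rel w v ↔ f.Rel v w :=
  PEquiv.mem_iff_mem f.1

theorem isInverse_iff {f g : CuntzMonoid n} : IsInverse f g ↔ g = f.symm := by
  have key : ∀ {f g : CuntzMonoid n}, f * g * f = f → ∀ {w v}, f.Rel w v → g.Rel v w := by
    intro f g h w v hw
    have h1 := hw
    rw [← h, rel_mul] at h1
    obtain ⟨u, hu, h1⟩ := h1
    obtain ⟨z, hz, h1⟩ := rel_mul.1 h1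
    obtain rfl := hu.right_unique hw
    obtain rfl := h1.left_unique hw
    exact hz
  have key' : ∀ f : CuntzMonoid n, f * f.symm * f = f := by
    intro f
    refine ext_rel fun w v => ?_
    simp only [rel_mul, rel_symm]
    constructor
    · rintro ⟨u, hu, z, hz, h⟩
      rwa [hu.left_unique hz]
    · exact fun h => ⟨v, h, w, h, h⟩
  constructor
  · rintro ⟨h1, h2⟩
    refine ext_rel fun w v => ?_
    rw [rel_symm]
    exact ⟨key h2, key h1⟩
  · rintro rfl
    exact ⟨key' f, key' f.symm⟩

theorem isInverseMonoid : IsInverseMonoid (CuntzMonoid n) := fun f =>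
  ⟨f.symm, isInverse_iff.2 rfl, fun _ h => isInverse_iff.1 h⟩

theorem isIdempotentElem_iff {f : CuntzMonoid n} :
    IsIdempotentElem f ↔ ∀ w v, f.Rel w v → w = v := by
  constructor
  · intro h w v hw
    have h1 := hw
    rw [← show f * f = f from h, rel_mul] at h1
    obtain ⟨u, hu, h1⟩ := h1
    obtain rfl := hu.right_unique hw
    exact hw.left_unique h1
  · intro h
    refine ext_rel fun w v => ?_
    rw [rel_mul]
    constructor
    · rintro ⟨u, hu, h1⟩
      rwa [h _ _ hu]
    · intro h1
      obtain rfl := h _ _ h1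
      exact ⟨w, h1, h1⟩

theorem natLE_iff {f g : CuntzMonoid n} : NatLE f g ↔ ∀ w v, f.Rel w v → g.Rel w v := by
  constructor
  · rintro ⟨e, he, rfl⟩ w v h
    obtain ⟨u, hu, h⟩ := rel_mul.1 h
    rwa [isIdempotentElem_iff.1 he _ _ hu]
  · intro h
    refine ⟨f.symm * f, isIdempotentElem_iff.2 fun w v h1 => ?_, ext_rel fun w v => ?_⟩
    · obtain ⟨u, hu, h1⟩ := rel_mul.1 h1
      exact hu.left_unique (rel_symm.1 h1)
    · simp only [rel_mul, rel_symm]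
      constructor
      · exact fun h1 => ⟨w, ⟨v, h1, h1⟩, h _ _ h1⟩
      · rintro ⟨u, ⟨z, hz, hz'⟩, h1⟩
        obtain rfl := hz.left_unique hz'
        obtain rfl := (h _ _ hz).right_unique h1
        exact hz

theorem natLE_antisymm {f g : CuntzMonoid n} (h : NatLE f g) (h' : NatLE g f) : f = g :=
  ext_rel fun w v => ⟨natLE_iff.1 h w v, natLE_iff.1 h' w v⟩

theorem exists_union {f g : CuntzMonoid n}
    (hr : ∀ w v v', f.Rel w v → g.Rel w v' → v = v')
    (hl : ∀ w w' v, f.Rel w v → g.Rel w' v → w = w') :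
    ∃ j : CuntzMonoid n, ∀ w v, j.Rel w v ↔ f.Rel w v ∨ g.Rel w v := by
  obtain ⟨N, hf, hg⟩ := exists_isLocalAt_two f g
  refine exists_of_isLocalAt (N := N) ?_ ?_ fun x hx => ?_
  · rintro w v v' (h | h) (h' | h')
    exacts [h.right_unique h', hr _ _ _ h h', (hr _ _ _ h' h).symm, h.right_unique h']
  · rintro w w' v (h | h) (h' | h')
    exacts [h.left_unique h', hl _ _ _ h h', (hl _ _ _ h' h).symm, h.left_unique h']
  · rcases hf x hx with h | ⟨y, h⟩
    · rcases hg x hx with h' | ⟨y, h'⟩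
      · exact Or.inl fun t v hv => hv.elim (h t v) (h' t v)
      · exact Or.inr ⟨y, fun t => Or.inr (h' t)⟩
    · exact Or.inr ⟨y, fun t => Or.inl (h t)⟩

theorem isJoin_of_rel {f g j : CuntzMonoid n}
    (h : ∀ w v, j.Rel w v ↔ f.Rel w v ∨ g.Rel w v) : IsJoin f g j := by
  refine ⟨natLE_iff.2 fun w v hw => (h w v).2 (Or.inl hw),
    natLE_iff.2 fun w v hw => (h w v).2 (Or.inr hw), fun c hf hg => natLE_iff.2 fun w v hw => ?_⟩
  exact ((h w v).1 hw).elim (natLE_iff.1 hf w v) (natLE_iff.1 hg w v)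

/-- Two elements with a common upper bound have a partial bijection as the union of their graphs,
and this union lies in the monoid; so any join equals it. -/
theorem isJoin_iff {f g j : CuntzMonoid n} :
    IsJoin f g j ↔ ∀ w v, j.Rel w v ↔ f.Rel w v ∨ g.Rel w v := by
  refine ⟨fun h => ?_, isJoin_of_rel⟩
  have h1 := natLE_iff.1 h.1
  have h2 := natLE_iff.1 h.2.1
  obtain ⟨u, hu⟩ := exists_union
    (fun w v v' hf hg => (h1 w v hf).right_unique (h2 w v' hg))
    (fun w w' v hf hg => (h1 w v hf).left_unique (h2 w' v hg))
  have hju := isJoin_of_rel hu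
  rwa [natLE_antisymm (h.2.2 u hju.1 hju.2.1) (hju.2.2 j h.1 h.2.1)]

theorem isDistributive : IsDistributive (CuntzMonoid n) where
  isInverseMonoid := isInverseMonoid
  exists_join f g h := by
    obtain ⟨f', g', hf, hg, h1, h2⟩ := h
    rw [isInverse_iff] at hf hg
    subst hf hg
    rw [isIdempotentElem_iff] at h1 h2
    obtain ⟨j, hj⟩ := exists_union (f := f) (g := g)
      (fun w v v' hf hg => (h1 v' v (rel_mul.2 ⟨w, rel_symm.2 hg, hf⟩)).symm)
      (fun w w' v hf hg => (h2 w' w (rel_mul.2 ⟨v, hg, rel_symm.2 hf⟩)).symm)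
    exact ⟨j, isJoin_of_rel hj⟩
  mul_join f g j c h := by
    rw [isJoin_iff] at h ⊢
    simp only [rel_mul, h, or_and_right, exists_or, implies_true]
  join_mul f g j c h := by
    rw [isJoin_iff] at h ⊢
    simp only [rel_mul, h, and_or_left, exists_or, implies_true]

theorem exists_isIdempotentElem {D : Set (Stream' (Fin n))} {N : ℕ}
    (h : ∀ x : List (Fin n), x.length = N → (∀ t, x ++ₛ t ∉ D) ∨ ∀ t, x ++ₛ t ∈ D) :
    ∃ e : CuntzMonoid n, IsIdempotentElem e ∧ ∀ w v, e.Rel w v ↔ w = v ∧ w ∈ D := by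
  obtain ⟨e, he⟩ := exists_of_isLocalAt (R := fun w v => w = v ∧ w ∈ D) (N := N)
    (fun a b b' h h' => h.1.symm.trans h'.1) (fun a a' b h h' => h.1.trans h'.1.symm)
    (fun x hx => (h x hx).imp (fun h t v hv => h t hv.2) fun h => ⟨x, fun t => ⟨rfl, h t⟩⟩)
  exact ⟨e, isIdempotentElem_iff.2 fun w v hw => ((he w v).1 hw).1, he⟩

/-- The domain of an idempotent. -/
def carrier (e : CuntzMonoid n) : Set (Stream' (Fin n)) := {w | e.Rel w w}

theorem rel_iff_of_isIdempotentElem {e : CuntzMonoid n} (he : IsIdempotentElem e)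
    {w v : Stream' (Fin n)} : e.Rel w v ↔ w = v ∧ w ∈ e.carrier := by
  constructor
  · intro h
    obtain rfl := isIdempotentElem_iff.1 he _ _ h
    exact ⟨rfl, h⟩
  · rintro ⟨rfl, h⟩
    exact h

/-- At sufficient depth, each cylinder lies entirely inside or entirely outside the domain of `e`.
-/
theorem exists_compl {e : CuntzMonoid n} (he : IsIdempotentElem e) :
    ∃ f : CuntzMonoid n, IsIdempotentElem f ∧ f.carrier = e.carrierᶜ := by
  obtain ⟨N, hN⟩ := exists_isLocalAt e
  obtain ⟨f, hf, h⟩ := exists_isIdempotentElem (D := e.carrierᶜ) (N := N) (fun x hx => by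
    rcases hN N le_rfl x hx with h | ⟨y, h⟩
    · exact Or.inr fun t ht => h t _ ht
    · refine Or.inl fun t ht => ht ?_
      have h1 := h t
      rwa [← isIdempotentElem_iff.1 he _ _ h1] at h1)
  refine ⟨f, hf, Set.ext fun w => ?_⟩
  change f.Rel w w ↔ _
  rw [h]
  exact and_iff_right rfl

theorem exists_inf {e f : CuntzMonoid n} (he : IsIdempotentElem e) (hf : IsIdempotentElem f) :
    ∃ g : CuntzMonoid n, IsIdempotentElem g ∧ g.carrier = e.carrier ∩ f.carrier := by
  have hrel : ∀ {w v}, (e * f).Rel w v ↔ w = v ∧ w ∈ e.carrier ∩ f.carrier := by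
    intro w v
    rw [rel_mul]
    constructor
    · rintro ⟨u, h1, h2⟩
      obtain ⟨rfl, h1⟩ := (rel_iff_of_isIdempotentElem hf).1 h1
      obtain ⟨rfl, h2⟩ := (rel_iff_of_isIdempotentElem he).1 h2
      exact ⟨rfl, h2, h1⟩
    · rintro ⟨rfl, h2, h1⟩
      exact ⟨w, h1, h2⟩
  exact ⟨e * f, isIdempotentElem_iff.2 fun w v h => (hrel.1 h).1,
    Set.ext fun w => hrel.trans (and_iff_right rfl)⟩

variable (n) in
/-- The Boolean algebra of domains of idempotents. -/
def carriers : BooleanSubalgebra (Set (Stream' (Fin n))) where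
  carrier := {D | ∃ e : CuntzMonoid n, IsIdempotentElem e ∧ e.carrier = D}
  supClosed' := by
    rintro _ ⟨e, he, rfl⟩ _ ⟨f, hf, rfl⟩
    obtain ⟨e', he', h1⟩ := exists_compl he
    obtain ⟨f', hf', h2⟩ := exists_compl hf
    obtain ⟨g, hg, h3⟩ := exists_inf he' hf'
    obtain ⟨g', hg', h4⟩ := exists_compl hg
    refine ⟨g', hg', ?_⟩
    rw [h4, h3, h1, h2, Set.compl_inter, compl_compl, compl_compl]
    rfl
  infClosed' := by
    rintro _ ⟨e, he, rfl⟩ _ ⟨f, hf, rfl⟩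
    exact exists_inf he hf
  compl_mem' := by
    rintro _ ⟨e, he, rfl⟩
    exact exists_compl he
  bot_mem' := ⟨0, IsIdempotentElem.zero, Set.eq_empty_of_forall_notMem fun _ => not_rel_zero⟩

/-- Idempotents correspond to their domains. -/
noncomputable def idemEquiv : Idem (CuntzMonoid n) ≃ carriers n :=
  Equiv.ofBijective (fun e => ⟨carrier e.1, e.1, e.2, rfl⟩) (by
    constructor
    · intro e f h
      have h : carrier e.1 = carrier f.1 := congrArg Subtype.val h
      refine Subtype.ext (ext_rel fun w v => ?_)
      rw [rel_iff_of_isIdempotentElem e.2, rel_iff_of_isIdempotentElem f.2, h]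
    · rintro ⟨_, e, he, rfl⟩
      exact ⟨⟨e, he⟩, rfl⟩)

theorem exists_booleanAlgebra : ∃ B : BooleanAlgebra (Idem (CuntzMonoid n)),
    ∀ e f : Idem (CuntzMonoid n), B.le e f ↔ NatLE (e : CuntzMonoid n) (f : CuntzMonoid n) := by
  refine ⟨idemEquiv.booleanAlgebra, fun e f => ?_⟩
  change carrier e.1 ⊆ carrier f.1 ↔ _
  rw [natLE_iff]
  constructor
  · intro h w v hw
    rw [rel_iff_of_isIdempotentElem e.2] at hw
    exact (rel_iff_of_isIdempotentElem f.2).2 ⟨hw.1, h hw.2⟩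
  · exact fun h w hw => h w w hw

/-- Two prefix replacements which agree on a cylinder replace the prefix by the same word. -/
theorem eq_of_forall_append_eq (hn : 2 ≤ n) {y z l : List (Fin n)}
    (h : ∀ s : Stream' (Fin n), y ++ₛ (l ++ₛ s) = z ++ₛ (l ++ₛ s)) : y = z := by
  have key : ∀ {y z : List (Fin n)}, (∀ s, y ++ₛ (l ++ₛ s) = z ++ₛ (l ++ₛ s)) →
      ¬y.length < z.length := by
    intro y z h hlt
    have h1 : ∀ s s' : Stream' (Fin n), s.get 0 = s'.get 0 := by
      intro s s'
      have hk : (y ++ l).length < (z ++ l).length := by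
        rw [List.length_append, List.length_append]; omega
      -- If `y` were shorter than `z`, the first letter of `s` would occupy a position inside the
      -- fixed word `z ++ l`.
      have h2 : ∀ s : Stream' (Fin n), s.get 0 = (z ++ l)[(y ++ l).length] := fun s => by
        rw [← Stream'.get_append_left (a := s) (h := hk), Stream'.append_append_stream, ← h s,
          ← Stream'.append_append_stream, Stream'.get_append_length]
      rw [h2, h2]
    have h2 := h1 (Stream'.const ⟨0, by omega⟩) (Stream'.const ⟨1, by omega⟩)
    simp at h2
  have hl : y.length = z.length :=
    le_antisymm (not_lt.1 (key fun s => (h s).symm)) (not_lt.1 (key h))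
  exact Stream'.append_left_injective _ _ _ _ (h (Stream'.const ⟨0, by omega⟩)) hl

/-- The intersection of the graphs may be too big: the identity and `a u ↦ a a u` agree only at the
isolated coincidence `a a a …`. The meet keeps the cylinders of a common depth on which both
elements insert the same word. -/
theorem exists_meet (hn : 2 ≤ n) (f g : CuntzMonoid n) : ∃ m, IsMeet f g m := by
  obtain ⟨N, hf, hg⟩ := exists_isLocalAt_two f g
  let R : Stream' (Fin n) → Stream' (Fin n) → Prop := fun w v => f.Rel w v ∧
    ∃ y, ∀ t, f.Rel (w.take N ++ₛ t) (y ++ₛ t) ∧ g.Rel (w.take N ++ₛ t) (y ++ₛ t)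
  have htake : ∀ x : List (Fin n), x.length = N → ∀ t, (x ++ₛ t).take N = x := fun x hx t => by
    rw [Stream'.take_append_of_le_length _ _ _ hx.ge, ← hx, List.take_length]
  obtain ⟨m, hm⟩ := exists_of_isLocalAt (R := R) (N := N)
    (fun a b b' h h' => h.1.right_unique h'.1) (fun a a' b h h' => h.1.left_unique h'.1)
    (fun x hx => by
      by_cases hy : ∃ y, ∀ t, f.Rel (x ++ₛ t) (y ++ₛ t) ∧ g.Rel (x ++ₛ t) (y ++ₛ t)
      · obtain ⟨y, hy⟩ := hy
        refine Or.inr ⟨y, fun t => ⟨(hy t).1, y, fun s => ?_⟩⟩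
        rw [htake x hx]
        exact hy s
      · refine Or.inl fun t v hv => hy ?_
        obtain ⟨-, y, hy⟩ := hv
        rw [htake x hx] at hy
        exact ⟨y, hy⟩)
  refine ⟨m, natLE_iff.2 fun w v h => ((hm w v).1 h).1, natLE_iff.2 fun w v h => ?_,
    fun c hcf hcg => natLE_iff.2 fun w v h => ?_⟩
  · obtain ⟨h1, y, hy⟩ := (hm w v).1 h
    have h2 := hy (w.drop N)
    rw [Stream'.append_take_drop] at h2
    rw [h1.right_unique h2.1]
    exact h2.2
  · rw [natLE_iff] at hcf hcg
    refine (hm w v).2 ⟨hcf w v h, ?_⟩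
    obtain ⟨K, hK⟩ := exists_isLocalAt c
    set x := w.take N
    set l := (w.drop N).take K
    have hw : w = x ++ₛ (l ++ₛ (w.drop N).drop K) := by
      rw [Stream'.append_take_drop, Stream'.append_take_drop]
    -- A lower bound `c` may be local only at a greater depth, but it makes `f` and `g` agree on the
    -- subcylinder of `x ++ l`; this already forces the same replacement on the whole cylinder of
    -- `x`.
    have hc : ∃ u, ∀ s, c.Rel (x ++ₛ (l ++ₛ s)) (u ++ₛ s) := by
      rcases hK (N + K) (by omega) (x ++ l) (by simp [x, l]) with h1 | ⟨u, h1⟩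
      · refine absurd h ?_
        rw [hw, ← Stream'.append_append_stream]
        exact h1 _ _
      · exact ⟨u, fun s => by rw [← Stream'.append_append_stream]; exact h1 s⟩
    obtain ⟨u, hu⟩ := hc
    rcases hf x (Stream'.length_take _ _) with h1 | ⟨y, hy⟩
    · exact absurd (hcf _ _ (hu w)) (h1 _ _)
    rcases hg x (Stream'.length_take _ _) with h1 | ⟨z, hz⟩
    · exact absurd (hcg _ _ (hu w)) (h1 _ _)
    have hyz : y = z := eq_of_forall_append_eq hn (l := l) fun s =>
      ((hy _).right_unique (hcf _ _ (hu s))).trans ((hcg _ _ (hu s)).right_unique (hz _))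
    exact ⟨y, fun t => ⟨hy t, hyz ▸ hz t⟩⟩

theorem isBooleanInverseMeetMonoid (hn : 2 ≤ n) : IsBooleanInverseMeetMonoid (CuntzMonoid n) where
  isDistributive := isDistributive
  boolean := exists_booleanAlgebra
  exists_meet := exists_meet hn

/-- The partial bijection `x u ↦ y u`. -/
theorem exists_shift (x y : List (Fin n)) :
    ∃ f : CuntzMonoid n, ∀ w v, f.Rel w v ↔ ∃ t, w = x ++ₛ t ∧ v = y ++ₛ t := by
  obtain ⟨f, hf⟩ := exists_pequiv (R := fun w v => ∃ t, w = x ++ₛ t ∧ v = y ++ₛ t)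
    (by
      rintro w v v' ⟨t, rfl, rfl⟩ ⟨t', h, rfl⟩
      rw [Stream'.append_right_injective _ _ _ h])
    (by
      rintro w w' v ⟨t, rfl, rfl⟩ ⟨t', rfl, h⟩
      rw [Stream'.append_right_injective _ _ _ h])
  refine ⟨⟨f, {(x, y)}, ⟨by simp, by simp⟩, fun w v => ?_⟩, hf⟩
  rw [hf]
  simp

/-! ### Cardinality and congruence-freeness of the Cuntz inverse monoid -/

theorem infinite (hn : 2 ≤ n) : Infinite (CuntzMonoid n) := by
  let a : Fin n := ⟨0, by omega⟩
  let b : Fin n := ⟨1, by omega⟩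
  obtain ⟨p, hp⟩ := exists_shift [] [a]
  obtain ⟨q, hq⟩ := exists_shift [a] []
  have hqp : q * p = 1 := by
    refine ext_rel fun w v => ?_
    simp only [rel_mul, hp, hq, rel_one, Stream'.nil_append_stream]
    constructor
    · rintro ⟨u, ⟨t, rfl, rfl⟩, t', h, rfl⟩
      exact Stream'.append_right_injective _ _ _ h
    · rintro rfl
      exact ⟨_, ⟨w, rfl, rfl⟩, w, rfl, rfl⟩
  rw [← not_finite_iff_infinite]
  intro hfin
  -- In a finite monoid one-sided inverses are two-sided, but `q` only strips the letter `a` and is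
  -- undefined at `b b b …`.
  have hpq : p * q = 1 := mul_eq_one_symm hqp
  have h1 : (p * q).Rel (Stream'.const b) (Stream'.const b) := by
    rw [hpq, rel_one]
  obtain ⟨u, hu, -⟩ := rel_mul.1 h1
  obtain ⟨t, ht, -⟩ := (hq _ _).1 hu
  have := congrArg (fun s => s.get 0) ht
  simp [a, b, Stream'.cons_append_stream] at this

theorem countable : Countable (CuntzMonoid n) := by
  choose F hF using fun f : CuntzMonoid n => f.2
  refine Function.Injective.countable (f := F) fun f g h => ext_rel fun w v => ?_
  exact ((hF f).2 w v).trans (h ▸ ((hF g).2 w v).symm)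

/-- A nonzero `p` replaces some prefix `x` by a word `y` on a whole cylinder; prepending `x` before
and deleting `y` after gives the identity. -/
theorem exists_mul_mul_eq_one {p : CuntzMonoid n} (hp : p ≠ 0) : ∃ s t, s * p * t = 1 := by
  have h1 : ∃ w v, p.Rel w v := by
    by_contra! h
    exact hp (ext_rel fun w v => ⟨fun h' => (h w v h').elim, fun h' => (not_rel_zero h').elim⟩)
  obtain ⟨w, v, hwv⟩ := h1
  obtain ⟨N, hN⟩ := exists_isLocalAt p
  rcases hN N le_rfl (w.take N) (Stream'.length_take _ _) with h | ⟨y, h⟩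
  · refine absurd hwv ?_
    have := h (w.drop N) v
    rwa [Stream'.append_take_drop] at this
  obtain ⟨s, hs⟩ := exists_shift y []
  obtain ⟨t, ht⟩ := exists_shift [] (w.take N)
  refine ⟨s, t, ext_rel fun a b => ?_⟩
  simp only [rel_mul, hs, ht, rel_one, Stream'.nil_append_stream]
  constructor
  · rintro ⟨_, ⟨_, rfl, rfl⟩, c, hc, d, rfl, rfl⟩
    exact Stream'.append_right_injective _ _ _ ((h a).right_unique hc)
  · rintro rfl
    exact ⟨_, ⟨a, rfl, rfl⟩, _, h a, a, rfl, rfl⟩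

theorem take_append_congr (z : List (Fin n)) {k : ℕ} {s s' : Stream' (Fin n)}
    (h : s.take k = s'.take k) : (z ++ₛ s).take k = (z ++ₛ s').take k := by
  have h1 : (z ++ₛ s).take (z.length + k) = (z ++ₛ s').take (z.length + k) := by
    rw [← Stream'.append_take, ← Stream'.append_take, h]
  have h2 := congrArg (List.take k) h1
  rwa [Stream'.take_take, Stream'.take_take, min_eq_right (by omega)] at h2

/-- Elements which differ can be separated by multiplying with idempotents on both sides. -/
theorem exists_mul_mul_eq_zero {f g : CuntzMonoid n} {w v : Stream' (Fin n)} (hf : f.Rel w v)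
    (hg : ¬g.Rel w v) : ∃ s t : CuntzMonoid n, s * f * t ≠ 0 ∧ s * g * t = 0 := by
  -- A product of cylinders around `(w, v)` missing the graph of `g`: either `g` is undefined near
  -- `w`, or its value at `w` differs from `v` in the first `k` letters, and those letters are
  -- constant near `w`.
  have key : ∃ k M, ∀ w' v', g.Rel w' v' → w'.take M = w.take M → v'.take k ≠ v.take k := by
    obtain ⟨N, hN⟩ := exists_isLocalAt g
    rcases hN N le_rfl (w.take N) (Stream'.length_take _ _) with h | ⟨z, h⟩
    · refine ⟨0, N, fun w' v' h1 h2 => absurd h1 ?_⟩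
      rw [← Stream'.append_take_drop N w', h2]
      exact h _ _
    · have hne : v ≠ z ++ₛ w.drop N := by
        rintro rfl
        have := h (w.drop N)
        rw [Stream'.append_take_drop] at this
        exact hg this
      have hk : ∃ k, v.take k ≠ (z ++ₛ w.drop N).take k := by
        by_contra! h1
        exact hne (Stream'.take_theorem _ _ h1)
      obtain ⟨k, hk⟩ := hk
      refine ⟨k, N + k, fun w' v' h1 h2 h3 => hk ?_⟩
      rw [Stream'.take_add, Stream'.take_add] at h2
      obtain ⟨h4, h5⟩ := List.append_inj h2 (by simp)
      have h6 := h (w'.drop N)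
      rw [← h4, Stream'.append_take_drop] at h6
      rw [← h3, h1.right_unique h6]
      exact take_append_congr z h5
  obtain ⟨k, M, hkM⟩ := key
  have hcyl : ∀ (s : Stream' (Fin n)) (K : ℕ) (e : CuntzMonoid n), (∀ w v, e.Rel w v ↔
      ∃ t, w = s.take K ++ₛ t ∧ v = s.take K ++ₛ t) → ∀ w v, e.Rel w v ↔
      w = v ∧ w.take K = s.take K := by
    intro s K e he w v
    rw [he]
    constructor
    · rintro ⟨t, rfl, rfl⟩
      refine ⟨rfl, ?_⟩
      rw [Stream'.take_append_of_le_length _ _ _ (by simp)]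
      simp
    · rintro ⟨rfl, h⟩
      exact ⟨w.drop K, by rw [← h, Stream'.append_take_drop],
        by rw [← h, Stream'.append_take_drop]⟩
  obtain ⟨s, hs⟩ := exists_shift (v.take k) (v.take k)
  obtain ⟨t, ht⟩ := exists_shift (w.take M) (w.take M)
  have hs := hcyl _ _ _ hs
  have ht := hcyl _ _ _ ht
  refine ⟨s, t, fun h0 => ?_, ext_rel fun a b => ⟨fun h => ?_, fun h => (not_rel_zero h).elim⟩⟩
  · have : (s * f * t).Rel w v :=
      rel_mul.2 ⟨w, (ht _ _).2 ⟨rfl, rfl⟩, rel_mul.2 ⟨v, hf, (hs _ _).2 ⟨rfl, rfl⟩⟩⟩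
    rw [h0] at this
    exact not_rel_zero this
  · exfalso
    obtain ⟨c, hc, h1⟩ := rel_mul.1 h
    obtain ⟨d, hd, h2⟩ := rel_mul.1 h1
    obtain ⟨rfl, hc'⟩ := (ht _ _).1 hc
    obtain ⟨rfl, h3⟩ := (hs _ _).1 h2
    exact hkM _ _ hd hc' h3

/-- A congruence relating two different elements relates a nonzero element to `0` by
`exists_mul_mul_eq_zero`, then `1` to `0` by `exists_mul_mul_eq_one`, and so everything to `0`. -/
theorem isCongruenceFree (hn : 2 ≤ n) : IsCongruenceFree (CuntzMonoid n) := by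
  have h01 : (0 : CuntzMonoid n) ≠ 1 := by
    intro h
    have h1 : (1 : CuntzMonoid n).Rel (Stream'.const ⟨0, by omega⟩)
        (Stream'.const ⟨0, by omega⟩) := rel_one.2 rfl
    rw [← h] at h1
    exact not_rel_zero h1
  have key : ∀ (c : Con (CuntzMonoid n)) (f g : CuntzMonoid n) (w v : Stream' (Fin n)), c f g →
      f.Rel w v → ¬g.Rel w v → c = ⊤ := by
    intro c f g w v hc hf hg
    obtain ⟨s, t, h1, h2⟩ := exists_mul_mul_eq_zero hf hg
    have h3 : c (s * f * t) (s * g * t) := c.mul (c.mul (c.refl s) hc) (c.refl t)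
    rw [h2] at h3
    obtain ⟨s', t', h4⟩ := exists_mul_mul_eq_one h1
    have h5 := c.mul (c.mul (c.refl s') h3) (c.refl t')
    rw [h4, mul_zero, zero_mul] at h5
    have h6 : ∀ x, c x 0 := fun x => by
      have := c.mul (c.refl x) h5
      rwa [mul_one, mul_zero] at this
    exact top_le_iff.1 fun x y _ => c.trans (h6 x) (c.symm (h6 y))
  refine Nat.card_eq_two_iff.2 ⟨⊥, ⊤, fun h => h01 ?_, Set.eq_univ_of_forall fun c => ?_⟩
  · have : (⊤ : Con (CuntzMonoid n)) 0 1 := trivial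
    rwa [← h] at this
  · rw [Set.mem_insert_iff, Set.mem_singleton_iff]
    by_cases hc : c = ⊤
    · exact Or.inr hc
    · refine Or.inl (le_bot_iff.1 fun x y hxy => ext_rel fun w v => ⟨fun h => ?_, fun h => ?_⟩)
      · by_contra h1
        exact hc (key c x y w v hxy h h1)
      · by_contra h1
        exact hc (key c y x w v (c.symm hxy) h h1)

/-! ### Units of the Cuntz inverse monoid -/

/-- Thompson permutations are units of the Cuntz inverse monoid. -/
def ofThompson (n : ℕ) : thompsonGroup n →* (CuntzMonoid n)ˣ where
  toFun g :=
    { val := ⟨g.1.toPEquiv, (isThompsonPerm_iff g.1).1 g.2⟩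
      inv := ⟨g.1.symm.toPEquiv, (isThompsonPerm_iff g.1⁻¹).1 (g⁻¹).2⟩
      val_inv := Subtype.ext (by
        change g.1.symm.toPEquiv.trans g.1.toPEquiv = PEquiv.refl _
        rw [← Equiv.toPEquiv_trans, Equiv.symm_trans_self, Equiv.toPEquiv_refl])
      inv_val := Subtype.ext (by
        change g.1.toPEquiv.trans g.1.symm.toPEquiv = PEquiv.refl _
        rw [← Equiv.toPEquiv_trans, Equiv.self_trans_symm, Equiv.toPEquiv_refl]) }
  map_one' := Units.ext (Subtype.ext Equiv.toPEquiv_refl)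
  map_mul' g h := Units.ext (Subtype.ext (Equiv.toPEquiv_trans h.1 g.1))

theorem rel_ofThompson {g : thompsonGroup n} {w v : Stream' (Fin n)} :
    (ofThompson n g).1.Rel w v ↔ g.1 w = v := Option.mem_some_iff

theorem ofThompson_bijective : Function.Bijective (ofThompson n) := by
  constructor
  · intro g h hgh
    refine Subtype.ext (Equiv.ext fun w => ?_)
    have h1 := rel_ofThompson (g := g).2 (rfl : g.1 w = g.1 w)
    rw [hgh, rel_ofThompson] at h1
    exact h1.symm
  · intro f
    -- Since `f⁻¹ * f = 1` is defined at every point, so is `f`; the same for `f⁻¹` makes `f` a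
    -- permutation.
    have hex : ∀ f : (CuntzMonoid n)ˣ, ∀ w, ∃ v, f.1.Rel w v ∧ (f⁻¹).1.Rel v w := by
      intro f w
      have h1 : (1 : CuntzMonoid n).Rel w w := rel_one.2 rfl
      rw [← f.inv_mul] at h1
      exact rel_mul.1 h1
    choose F hF using hex f
    choose F' hF' using hex f⁻¹
    let g : Equiv.Perm (Stream' (Fin n)) := ⟨F, F', fun w => by
      exact (hF' (F w)).1.right_unique (hF w).2, fun w => by
      exact (hF (F' w)).1.right_unique (hF' w).2⟩
    have hg : g.toPEquiv = f.1.1 := PEquiv.ext fun w => (Option.mem_def.1 (hF w).1).symm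
    refine ⟨⟨g, (isThompsonPerm_iff g).2 (hg ▸ f.1.2)⟩, Units.ext (Subtype.ext hg)⟩

end CuntzMonoid

end BooleanInverse

theorem corollary1p2 :
    (∀ (S : Type u) (T : Type v) [MonoidWithZero S] [MonoidWithZero T]
      [Countable S] [Infinite S] [Countable T] [Infinite T],
      BooleanInverse.IsBooleanInverseMeetMonoid S → BooleanInverse.IsCongruenceFree S →
      BooleanInverse.IsBooleanInverseMeetMonoid T → BooleanInverse.IsCongruenceFree T →
      (Nonempty (S ≃* T) ↔ Nonempty (Sˣ ≃* Tˣ))) ∧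
    (∀ n : ℕ, 2 ≤ n →
      Countable (BooleanInverse.CuntzMonoid n) ∧
      Infinite (BooleanInverse.CuntzMonoid n) ∧
      BooleanInverse.IsBooleanInverseMeetMonoid (BooleanInverse.CuntzMonoid n) ∧
      BooleanInverse.IsCongruenceFree (BooleanInverse.CuntzMonoid n) ∧
      Nonempty ((BooleanInverse.CuntzMonoid n)ˣ ≃* BooleanInverse.thompsonGroup n)) := by
  refine ⟨?_, fun n hn => ⟨BooleanInverse.CuntzMonoid.countable,
    BooleanInverse.CuntzMonoid.infinite hn,
    BooleanInverse.CuntzMonoid.isBooleanInverseMeetMonoid hn,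
    BooleanInverse.CuntzMonoid.isCongruenceFree hn,
    ⟨(MulEquiv.ofBijective _ BooleanInverse.CuntzMonoid.ofThompson_bijective).symm⟩⟩⟩
  intro S T _ _ _ _ _ _ hS hS' hT hT'
  refine ⟨fun ⟨ψ⟩ => ⟨Units.mapEquiv ψ⟩, fun ⟨φ⟩ => ?_⟩
  obtain ⟨_⟩ := hS.nonempty
  obtain ⟨_⟩ := hT.nonempty
  exact BooleanInverse.nonempty_mulEquiv hS' hT' φ
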